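/- **Setting.** Let $\eta=(\eta_{ab})$ be a constant symmetric non-degenerate $D\times D$ matrix of any signature; it and its inverse $\eta^{ab}$ lower and raise Latin indices, and repeated indices are summed. Let a four-dimensional brane $\mathcal M^{2n}\subset\mathbb R^D$, $2n=4$, be given in coordinates on an open set $U\subset\mathbb R^4$ by smooth functions $x^a:U\to\mathbb R$, $a=1,\dots,D$, with non-degenerate induced metric $g_{\mu\nu}=\eta_{ab}\,\partial_\mu x^a\partial_\nu x^b$. Let $\theta^{\mu\nu}$ be a smooth non-degenerate Poisson tensor on $U$ (antisymmetric, satisfying the Jacobi identity), $\{f,h\}=\theta^{\mu\nu}\partial_\mu f\,\partial_\nu h$, and $\rho=\sqrt{\det\theta^{-1}_{\mu\nu}}$. Let $\sigma:U\to\mathbb R$ be defined by $$G^{\mu\nu}=e^{-\sigma}\theta^{\mu\kappa}\theta^{\nu\lambda}g_{\kappa\lambda},\qquad e^{-\sigma}=\frac{\rho}{\sqrt{|\det G_{\mu\nu}|}},$$ where $G_{\mu\nu}$ is the inverse of $G^{\mu\nu}$, and assume $G_{\mu\nu}=g_{\mu\nu}$ on $U$. Write $\sqrt g=\sqrt{|\det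 g_{\mu\nu}|}$, $\square_g$ for the Laplace–Beltrami operator of $g$, and $R$ for its Ricci scalar (positive on round spheres). For matrices $X^1,\dots,X^D$ put $\square Y=[X^b,[X_b,Y]]$ and, with $\{A,B\}_+=AB+BA$, $$T^{ab}=\tfrac12\{[X^a,X^c],[X^b,X_c]\}_+-\tfrac14\eta^{ab}[X^c,X^d][X_c,X_d].$$ The semi-classical limit $\sim$ of an expression formed from the $X^a$ by real scalars, sums, products and commutators is the function on $U$ obtained by replacing $X^a$ by $x^a$, products by pointwise products of functions, and every commutator $[A,B]$ by $i\{A,B\}$; the limit of a trace is $\mathrm{Tr}\,A\sim(2\pi)^{-2}\int_U d^4x\,\rho\,a$ if $A\sim a$. **Claim.** 1. On $U$, $T^{ab}\sim e^\sigma\mathcal P_N^{ab}$ with $\mathcal P_N^{ab}=\eta^{ab}-g^{\mu\nu}\partial_\mu x^a\partial_\nu x^b$, and $e^\sigma=\tfrac14\{x^a,x^b\}\{x_a,x_b\}$. 2. Suppose that the density $\rho\,s$, where $s$ is the semi-classical limit of $[X^a,T^{bc}][X_a,T_{bc}]+2T^{bc}\,\square X_b\,\square X_c$, and the density on the right-hand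 side below are both integrable on $U$, and that the current $w^\mu=\sqrt g\,e^\sigma g^{\mu\nu}\partial_\nu e^\sigma$ has no flux through the boundary or infinity of $U$: there are $\chi_k\in C_c^\infty(U)$ with $0\le\chi_k\le1$ and $\chi_k\to1$ pointwise on $U$ such that $\int_U w^\mu\partial_\mu\chi_k\,d^4x\to0$. Then $$(2\pi)^2\,\mathrm{Tr}\big([X^a,T^{bc}][X_a,T_{bc}]+2T^{bc}\,\square X_b\,\square X_c\big)\sim\int_U d^4x\,\sqrt g\,\big[(D-4)\,e^\sigma\square_g e^\sigma+2e^{2\sigma}R\big].$$ 3. The integral giving the limit on the left-hand side below converges absolutely if and only if the integral on the right-hand side does, and then $$(2\pi)^2\,\mathrm{Tr}\big([X^a,X^b][X_a,X_b]\;\square([X^c,X^d][X_c,X_d])\big)\sim-16\int_U d^4x\,\sqrt g\,e^\sigma\square_g e^\sigma.$$ -/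

import Mathlib

open scoped ContDiff

noncomputable section

namespace MatrixModel

/-! ### Matrix expressions and their semi-classical limit -/

/-- Expressions built from `D` matrices `X^a` by real scalars, sums, products and commutators;
`sum F` is the sum of `F a` over the index `a = 1, …, D`, and `comm A B` stands for `[A, B]`. -/
inductive MatrixExpr (D : ℕ) : Type
  | X (a : Fin D) : MatrixExpr D
  | smul (c : ℝ) (A : MatrixExpr D) : MatrixExpr D
  | add (A B : MatrixExpr D) : MatrixExpr D
  | mul (A B : MatrixExpr D) : MatrixExpr D
  | comm (A B : MatrixExpr D) : MatrixExpr D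
  | sum (F : Fin D → MatrixExpr D) : MatrixExpr D

/-- Points of the coordinate domain of the four-dimensional brane. -/
abbrev Pt : Type := Fin 4 → ℝ

/-- The partial derivative `∂_μ f`. -/
def pd {F : Type*} [NormedAddCommGroup F] [NormedSpace ℝ F] (μ : Fin 4) (f : Pt → F) (y : Pt) : F :=
  fderiv ℝ f y (Pi.single μ 1)

/-- The Poisson bracket `{f, g} = θ^{μν} ∂_μ f ∂_ν g`, for real or complex functions. -/
def pb {𝕜 : Type*} [RCLike 𝕜] (θ : Pt → Matrix (Fin 4) (Fin 4) ℝ) (f g : Pt → 𝕜) (y : Pt) : 𝕜 :=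
  ∑ μ, ∑ ν, θ y μ ν • (pd μ f y * pd ν g y)

/-- A non-degenerate smooth Poisson tensor on `U`: antisymmetric, invertible, and satisfying the
Jacobi identity. -/
structure IsSymplecticPoisson (U : Set Pt) (θ : Pt → Matrix (Fin 4) (Fin 4) ℝ) : Prop where
  smooth : ∀ μ ν, ContDiffOn ℝ ∞ (fun y => θ y μ ν) U
  antisymm : ∀ y ∈ U, ∀ μ ν, θ y μ ν = -θ y ν μ
  nondeg : ∀ y ∈ U, (θ y).det ≠ 0
  jacobi : ∀ y ∈ U, ∀ μ ν κ,
    ∑ l, (θ y μ l * pd l (fun z => θ z ν κ) y + θ y ν l * pd l (fun z => θ z κ μ) y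
      + θ y κ l * pd l (fun z => θ z μ ν) y) = 0

/-- The symplectic density `ρ = √(det θ⁻¹)`. -/
def rho (θ : Pt → Matrix (Fin 4) (Fin 4) ℝ) (y : Pt) : ℝ := Real.sqrt ((θ y)⁻¹).det

/-- The semi-classical limit of a matrix expression: `X^a` is replaced by the embedding function
`x^a`, the matrix product by the product of functions, and every commutator `[A, B]` by
`i {A, B}`. -/
def MatrixExpr.limit {D : ℕ} (θ : Pt → Matrix (Fin 4) (Fin 4) ℝ) (x : Fin D → Pt → ℝ) :
    MatrixExpr D → Pt → ℂ
  | .X a => fun y => (x a y : ℂ)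
  | .smul c A => fun y => (c : ℂ) * A.limit θ x y
  | .add A B => fun y => A.limit θ x y + B.limit θ x y
  | .mul A B => fun y => A.limit θ x y * B.limit θ x y
  | .comm A B => fun y => Complex.I * pb θ (A.limit θ x) (B.limit θ x) y
  | .sum F => fun y => ∑ a, (F a).limit θ x y

/-- The density `ρ A` whose integral gives the semi-classical limit of `(2π)² Tr A`. -/
def traceDensity {D : ℕ} (θ : Pt → Matrix (Fin 4) (Fin 4) ℝ) (x : Fin D → Pt → ℝ)
    (A : MatrixExpr D) (y : Pt) : ℂ :=
  (rho θ y : ℂ) * A.limit θ x y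

/-- The semi-classical limit of the trace, `Tr A ∼ (2π)⁻² ∫ d⁴x ρ A`. -/
def traceLimit {D : ℕ} (U : Set Pt) (θ : Pt → Matrix (Fin 4) (Fin 4) ℝ) (x : Fin D → Pt → ℝ)
    (A : MatrixExpr D) : ℂ :=
  ((2 * Real.pi : ℝ) : ℂ)⁻¹ ^ 2 * ∫ y in U, traceDensity θ x A y

/-! ### The matrix expressions of order ten

`η` is the background metric `η_{ab}`, and `η⁻¹` is `η^{ab}`. -/

namespace MatrixExpr

variable {D : ℕ}

/-- The anticommutator. -/
def acomm (A B : MatrixExpr D) : MatrixExpr D := add (mul A B) (mul B A)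

/-- Lowering the index of a vector of expressions: `Y_a = η_{ab} Y^b`. -/
def lower (η : Matrix (Fin D) (Fin D) ℝ) (Y : Fin D → MatrixExpr D) (a : Fin D) : MatrixExpr D :=
  sum fun b => smul (η a b) (Y b)

/-- `□ Y = [X^b, [X_b, Y]]`. -/
def box (η : Matrix (Fin D) (Fin D) ℝ) (Y : MatrixExpr D) : MatrixExpr D :=
  sum fun b => comm (X b) (comm (lower η X b) Y)

/-- `[X^c, X^d] [X_c, X_d]`. -/
def commSq (η : Matrix (Fin D) (Fin D) ℝ) : MatrixExpr D :=
  sum fun c => sum fun d => mul (comm (X c) (X d)) (comm (lower η X c) (lower η X d))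

/-- `T^{ab} = ½ {[X^a, X^c], [X^b, X_c]}₊ - ¼ η^{ab} [X^c, X^d] [X_c, X_d]`. -/
def T (η : Matrix (Fin D) (Fin D) ℝ) (a b : Fin D) : MatrixExpr D :=
  add (smul (1 / 2) (sum fun c => acomm (comm (X a) (X c)) (comm (X b) (lower η X c))))
    (smul (-(1 / 4) * η⁻¹ a b) (commSq η))

/-- `T_{ab} = η_{ac} η_{bd} T^{cd}`. -/
def Tlow (η : Matrix (Fin D) (Fin D) ℝ) (a b : Fin D) : MatrixExpr D :=
  sum fun c => sum fun d => smul (η a c * η b d) (T η c d)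

/-- `□ X_a`. -/
def boxXlow (η : Matrix (Fin D) (Fin D) ℝ) (a : Fin D) : MatrixExpr D :=
  box η (lower η X a)

/-- `[X^a, T^{bc}] [X_a, T_{bc}] + 2 T^{bc} □X_b □X_c`. -/
def S10 (η : Matrix (Fin D) (Fin D) ℝ) : MatrixExpr D :=
  add
    (sum fun a => sum fun b => sum fun c =>
      mul (comm (X a) (T η b c)) (comm (lower η X a) (Tlow η b c)))
    (smul 2 (sum fun b => sum fun c => mul (mul (T η b c) (boxXlow η b)) (boxXlow η c)))

/-- `[X^a, X^b] [X_a, X_b] □([X^c, X^d] [X_c, X_d])`. -/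
def S10tilde (η : Matrix (Fin D) (Fin D) ℝ) : MatrixExpr D :=
  mul (commSq η) (box η (commSq η))

end MatrixExpr

/-! ### Geometry of the brane -/

/-- The induced metric `g_{μν} = η_{ab} ∂_μ x^a ∂_ν x^b`. -/
def inducedMetric {D : ℕ} (η : Matrix (Fin D) (Fin D) ℝ) (x : Fin D → Pt → ℝ) (y : Pt) :
    Matrix (Fin 4) (Fin 4) ℝ :=
  Matrix.of fun μ ν => ∑ a, ∑ b, η a b * pd μ (x a) y * pd ν (x b) y

/-- The volume density `√|det h|` of a metric `h`. -/
def sqrtDet (h : Pt → Matrix (Fin 4) (Fin 4) ℝ) (y : Pt) : ℝ := Real.sqrt |(h y).det|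

/-- The inverse effective metric `G^{μν} = e^{-σ} θ^{μκ} θ^{νl} g_{κl}`. -/
def effectiveInv (θ g : Pt → Matrix (Fin 4) (Fin 4) ℝ) (σ : Pt → ℝ) (y : Pt) :
    Matrix (Fin 4) (Fin 4) ℝ :=
  Matrix.of fun μ ν => Real.exp (-σ y) * ∑ κ, ∑ l, θ y μ κ * θ y ν l * g y κ l

/-- The effective metric `G_{μν}`. -/
def effectiveMetric (θ g : Pt → Matrix (Fin 4) (Fin 4) ℝ) (σ : Pt → ℝ) (y : Pt) :
    Matrix (Fin 4) (Fin 4) ℝ :=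
  (effectiveInv θ g σ y)⁻¹

/-- The Laplace-Beltrami operator `□_h f = |h|^{-1/2} ∂_μ (|h|^{1/2} h^{μν} ∂_ν f)`. -/
def laplaceBeltrami (h : Pt → Matrix (Fin 4) (Fin 4) ℝ) (f : Pt → ℝ) (y : Pt) : ℝ :=
  (sqrtDet h y)⁻¹ * ∑ μ, pd μ (fun z => ∑ ν, sqrtDet h z * (h z)⁻¹ μ ν * pd ν f z) y

/-- The Christoffel symbols `Γ^l_{μν}` of the Levi-Civita connection of `h`. -/
def christoffel (h : Pt → Matrix (Fin 4) (Fin 4) ℝ) (l μ ν : Fin 4) (y : Pt) : ℝ :=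
  1 / 2 * ∑ κ, (h y)⁻¹ l κ *
    (pd μ (fun z => h z κ ν) y + pd ν (fun z => h z κ μ) y - pd κ (fun z => h z μ ν) y)

/-- The Ricci tensor, with the sign for which round spheres have positive curvature. -/
def ricci (h : Pt → Matrix (Fin 4) (Fin 4) ℝ) (μ ν : Fin 4) (y : Pt) : ℝ :=
  ∑ l, (pd l (christoffel h l μ ν) y - pd ν (christoffel h l l μ) y)
    + ∑ l, ∑ κ, (christoffel h l l κ y * christoffel h κ μ ν y
      - christoffel h l ν κ y * christoffel h κ l μ y)

/-- The Ricci scalar `R = h^{μν} R_{μν}`. -/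
def scalarCurvature (h : Pt → Matrix (Fin 4) (Fin 4) ℝ) (y : Pt) : ℝ :=
  ∑ μ, ∑ ν, (h y)⁻¹ μ ν * ricci h μ ν y

/-- The projector `P_N^{ab} = η^{ab} - g^{μν} ∂_μ x^a ∂_ν x^b` on the normal space. -/
def normalProjector {D : ℕ} (η : Matrix (Fin D) (Fin D) ℝ) (x : Fin D → Pt → ℝ) (a b : Fin D)
    (y : Pt) : ℝ :=
  η⁻¹ a b - ∑ μ, ∑ ν, (inducedMetric η x y)⁻¹ μ ν * pd μ (x a) y * pd ν (x b) y

/-- `√|g| [(D - 4) e^σ □_g e^σ + 2 e^{2σ} R]`. -/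
def gravityDensity (D : ℕ) (g : Pt → Matrix (Fin 4) (Fin 4) ℝ) (σ : Pt → ℝ) (y : Pt) : ℝ :=
  sqrtDet g y * (((D : ℝ) - 4) * (Real.exp (σ y) *
      laplaceBeltrami g (fun z => Real.exp (σ z)) y)
    + 2 * Real.exp (2 * σ y) * scalarCurvature g y)

/-- `√|g| e^σ □_g e^σ`. -/
def dilatonDensity (g : Pt → Matrix (Fin 4) (Fin 4) ℝ) (σ : Pt → ℝ) (y : Pt) : ℝ :=
  sqrtDet g y * (Real.exp (σ y) * laplaceBeltrami g (fun z => Real.exp (σ z)) y)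

/-- The vector density `√|g| e^σ ∂^μ e^σ`. -/
def dilatonCurrent (g : Pt → Matrix (Fin 4) (Fin 4) ℝ) (σ : Pt → ℝ) (μ : Fin 4) (y : Pt) : ℝ :=
  sqrtDet g y * Real.exp (σ y) * ∑ ν, (g y)⁻¹ μ ν * pd ν (fun z => Real.exp (σ z)) y

/-- The vector density `w` has no flux through the boundary (or the infinity) of `U`: for some
smooth cut-offs `χ_k` with compact support in `U`, values in `[0, 1]` and pointwise limit `1`
on `U`, the integrals `∫ w^μ ∂_μ χ_k` tend to `0`. -/
def NoBoundaryFlux (U : Set Pt) (w : Fin 4 → Pt → ℝ) : Prop :=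
  ∃ χ : ℕ → Pt → ℝ,
    (∀ k, ContDiff ℝ ∞ (χ k) ∧ HasCompactSupport (χ k) ∧ tsupport (χ k) ⊆ U ∧
      ∀ y, χ k y ∈ Set.Icc (0 : ℝ) 1) ∧
    (∀ y ∈ U, Filter.Tendsto (fun k => χ k y) Filter.atTop (nhds 1)) ∧
    Filter.Tendsto (fun k => ∫ y in U, ∑ μ, w μ y * pd μ (χ k) y) Filter.atTop (nhds 0)

end MatrixModel

end

/-!
The hypothesis `G = g` says `θ g θᵀ = e^σ g⁻¹`. Contracting with the Jacobian of the embedding,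
`{x^a, x^c} {x^b, x_c} = e^σ g^{μν} ∂_μ x^a ∂_ν x^b` (`sum_pb_mul_pb`), whose trace is `4 e^σ`;
this is the formula for `e^σ` and gives `T^{ab} ∼ e^σ P_N^{ab}` (`limit_T`). In particular `e^σ`
and `ρ = e^{-σ} √g` are smooth on `U`.

The Jacobi identity gives `∂_μ (ρ θ^{μν}) = 0` (`liouville`; in four dimensions `ρ` is the inverse
of the Pfaffian up to sign). Hence `ρ {u, v}` is a divergence, and since `ρ e^σ = √g`, the double
bracket `{x^a, {x_a, f}}` equals `e^σ □_g f` (`sum_pb_pb`). As the limit of `[X^c, X^d] [X_c,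
X_d]` is `-4 e^σ`, the third claim is an equality of densities.

For the second claim put `s = e^σ` and let `K_{μν} = ∇_μ ∂_ν x` be the second fundamental form,
which is normal to the brane. The derivative term contributes `-s g^{μν} ∂_μ (s P_N) · ∂_ν (s
P_N)`. Since `P_N` is a projector of rank `D - 4` and `∂_λ P_N` is built from one factor `K` and
one factor `∂x`, this is `-(D - 4) s |∂s|² - 2 s³ ⟨K_{μν}, K^{μν}⟩`
(`gradient_sq_smul_normalMatrix`). The other term sees only the normal part `K^μ_μ` of `□_g x` and
contributes `2 s³ ⟨K^μ_μ, K^ν_ν⟩` (`normalMatrix_laplaceBeltrami`). By the contracted Gauss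
equation (`scalarCurvature_eq`) the sum is `s (2 s² R - (D - 4) |∂s|²)`, and multiplication by `ρ`
gives a density which differs from `√g [(D - 4) s □_g s + 2 s² R]` by `D - 4` times the divergence
of the dilaton current (`traceDensity_S10`). That divergence integrates to zero: integrate by
parts against the cut-offs (`setIntegral_divergence_eq_zero`).

The curvature computation is done with matrix-valued functions: `jac` is the Jacobian `∂_μ x^a`,
`connection` and `sff` are families of matrices indexed by a derivative direction, and `mpd` is
the entrywise derivative, which obeys the Leibniz rule for matrix products.
-/

noncomputable section

namespace MatrixModel

/-! ### Partial derivatives of functions and of matrix-valued functions -/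

section Calculus

variable {U : Set Pt} {f h : Pt → ℝ} {y : Pt}

theorem pd_congr (hU : IsOpen U) (hy : y ∈ U) (H : ∀ z ∈ U, f z = h z) (μ : Fin 4) :
    pd μ f y = pd μ h y := by
  have : f =ᶠ[nhds y] h := Filter.eventuallyEq_of_mem (hU.mem_nhds hy) H
  simp only [pd, this.fderiv_eq]

theorem pd_add (hf : DifferentiableAt ℝ f y) (hh : DifferentiableAt ℝ h y) (μ : Fin 4) :
    pd μ (fun z => f z + h z) y = pd μ f y + pd μ h y := by
  simp only [pd, fderiv_fun_add hf hh, add_apply]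

theorem pd_sub (hf : DifferentiableAt ℝ f y) (hh : DifferentiableAt ℝ h y) (μ : Fin 4) :
    pd μ (fun z => f z - h z) y = pd μ f y - pd μ h y := by
  simp only [pd, fderiv_fun_sub hf hh, sub_apply]

theorem pd_neg (μ : Fin 4) : pd μ (fun z => -f z) y = -pd μ f y := by
  simp only [pd, fderiv_fun_neg, neg_apply]

theorem pd_mul (hf : DifferentiableAt ℝ f y) (hh : DifferentiableAt ℝ h y) (μ : Fin 4) :
    pd μ (fun z => f z * h z) y = pd μ f y * h y + f y * pd μ h y := by
  simp only [pd, fderiv_fun_mul hf hh, add_apply,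
    smul_apply, smul_eq_mul]
  ring

theorem pd_const (c : ℝ) (μ : Fin 4) : pd μ (fun _ => c) y = 0 := by
  simp [pd]

theorem pd_const_mul (hf : DifferentiableAt ℝ f y) (c : ℝ) (μ : Fin 4) :
    pd μ (fun z => c * f z) y = c * pd μ f y := by
  simp [pd, fderiv_const_mul hf]

theorem pd_sum {ι : Type*} {s : Finset ι} {F : ι → Pt → ℝ}
    (hF : ∀ i ∈ s, DifferentiableAt ℝ (F i) y) (μ : Fin 4) :
    pd μ (fun z => ∑ i ∈ s, F i z) y = ∑ i ∈ s, pd μ (F i) y := by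
  simp only [pd, fderiv_fun_sum hF, sum_apply]

theorem pd_sum_sum_const_mul {ι : Type*} [Fintype ι] {c : ι → ι → ℝ} {F : ι → ι → Pt → ℝ}
    (hF : ∀ a b, DifferentiableAt ℝ (F a b) y) (μ : Fin 4) :
    pd μ (fun z => ∑ a, ∑ b, c a b * F a b z) y = ∑ a, ∑ b, c a b * pd μ (F a b) y := by
  rw [pd_sum (F := fun a z => ∑ b, c a b * F a b z) fun a _ =>
    DifferentiableAt.fun_sum fun b _ => (hF a b).const_mul _]
  refine Finset.sum_congr rfl fun a _ => ?_
  rw [pd_sum (F := fun b z => c a b * F a b z) fun b _ => (hF a b).const_mul _]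
  exact Finset.sum_congr rfl fun b _ => pd_const_mul (hF a b) _ μ

theorem differentiableAt_of_contDiffOn (hU : IsOpen U) (hf : ContDiffOn ℝ ∞ f U) (hy : y ∈ U) :
    DifferentiableAt ℝ f y :=
  (hf.contDiffAt (hU.mem_nhds hy)).differentiableAt (by simp)

theorem contDiffOn_pd (hU : IsOpen U) (hf : ContDiffOn ℝ ∞ f U) (μ : Fin 4) :
    ContDiffOn ℝ ∞ (pd μ f) U :=
  (hf.fderiv_of_isOpen hU (m := ∞) (by simp)).clm_apply contDiffOn_const

theorem pd_comm (hU : IsOpen U) (hf : ContDiffOn ℝ ∞ f U) (hy : y ∈ U) (μ ν : Fin 4) :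
    pd μ (pd ν f) y = pd ν (pd μ f) y := by
  have hfy : ContDiffAt ℝ ∞ f y := hf.contDiffAt (hU.mem_nhds hy)
  have hs : IsSymmSndFDerivAt ℝ f y := hfy.isSymmSndFDerivAt (by
    rw [minSmoothness_of_isRCLikeNormedField]
    exact WithTop.coe_le_coe.2 (le_top : (2 : ℕ∞) ≤ ⊤))
  have hd : DifferentiableAt ℝ (fderiv ℝ f) y :=
    ((hf.fderiv_of_isOpen hU (m := ∞) (by simp)).contDiffAt (hU.mem_nhds hy)).differentiableAt
      (by simp)
  have key : ∀ α β : Fin 4, pd α (pd β f) y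
      = fderiv ℝ (fderiv ℝ f) y (Pi.single α 1) (Pi.single β 1) := by
    intro α β
    have : pd β f = fun z => fderiv ℝ f z (Pi.single β 1) := rfl
    rw [this, pd, fderiv_clm_apply hd (differentiableAt_const _)]
    simp
  rw [key, key]
  exact hs _ _

end Calculus

section MatrixCalculus

variable {l m n : Type*} {U : Set Pt} {y : Pt}

/-- The entrywise partial derivative `∂_μ M` of a matrix-valued function. -/
def mpd (μ : Fin 4) (M : Pt → Matrix m n ℝ) (y : Pt) : Matrix m n ℝ :=
  Matrix.of fun i j => pd μ (fun z => M z i j) y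

/-- Smoothness on `U` of all entries of a matrix-valued function. -/
def MSmooth (M : Pt → Matrix m n ℝ) (U : Set Pt) : Prop :=
  ∀ i j, ContDiffOn ℝ ∞ (fun z => M z i j) U

theorem MSmooth.diff {M : Pt → Matrix m n ℝ} (hM : MSmooth M U) (hU : IsOpen U) (hy : y ∈ U)
    (i : m) (j : n) : DifferentiableAt ℝ (fun z => M z i j) y :=
  differentiableAt_of_contDiffOn hU (hM i j) hy

theorem MSmooth.transpose {M : Pt → Matrix m n ℝ} (hM : MSmooth M U) :
    MSmooth (fun z => (M z).transpose) U := fun i j => hM j i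

theorem MSmooth.const (C : Matrix m n ℝ) : MSmooth (fun _ => C) U := fun _ _ => contDiffOn_const

theorem MSmooth.mul [Fintype m] {M : Pt → Matrix l m ℝ} {N : Pt → Matrix m n ℝ}
    (hM : MSmooth M U) (hN : MSmooth N U) : MSmooth (fun z => M z * N z) U := by
  intro i j
  simp only [Matrix.mul_apply]
  exact ContDiffOn.sum fun k _ => (hM i k).mul (hN k j)

theorem MSmooth.sub {M N : Pt → Matrix m n ℝ} (hM : MSmooth M U) (hN : MSmooth N U) :
    MSmooth (fun z => M z - N z) U := fun i j => (hM i j).sub (hN i j)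

theorem MSmooth.mpd {M : Pt → Matrix m n ℝ} (hM : MSmooth M U) (hU : IsOpen U) (μ : Fin 4) :
    MSmooth (mpd μ M) U := fun i j => contDiffOn_pd hU (hM i j) μ

theorem MSmooth.det [Fintype n] [DecidableEq n] {M : Pt → Matrix n n ℝ} (hM : MSmooth M U) :
    ContDiffOn ℝ ∞ (fun z => (M z).det) U := by
  simp only [Matrix.det_apply']
  exact ContDiffOn.sum fun p _ => contDiffOn_const.mul (contDiffOn_prod fun i _ => hM _ _)

theorem MSmooth.inv [Fintype n] [DecidableEq n] {M : Pt → Matrix n n ℝ} (hM : MSmooth M U)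
    (hdet : ∀ z ∈ U, (M z).det ≠ 0) : MSmooth (fun z => (M z)⁻¹) U := by
  intro i j
  have : (fun z => (M z)⁻¹ i j)
      = fun z => ((M z).det)⁻¹ * ((M z).updateRow j (Pi.single i 1)).det := by
    funext z
    simp [Matrix.inv_def, Matrix.adjugate_apply]
  rw [this]
  refine (hM.det.inv hdet).mul (MSmooth.det fun a b => ?_)
  by_cases h : a = j
  · subst h; simpa using contDiffOn_const
  · simpa [Matrix.updateRow_ne h] using hM a b

theorem mpd_congr (hU : IsOpen U) (hy : y ∈ U) {M N : Pt → Matrix m n ℝ}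
    (H : ∀ z ∈ U, M z = N z) (μ : Fin 4) : mpd μ M y = mpd μ N y := by
  ext i j
  exact pd_congr hU hy (fun z hz => by rw [H z hz]) μ

theorem mpd_const (C : Matrix m n ℝ) (μ : Fin 4) : mpd μ (fun _ => C) y = 0 := by
  ext i j
  exact pd_const _ μ

theorem mpd_transpose (M : Pt → Matrix m n ℝ) (μ : Fin 4) :
    mpd μ (fun z => (M z).transpose) y = (mpd μ M y).transpose := rfl

theorem mpd_sub {M N : Pt → Matrix m n ℝ} (hU : IsOpen U) (hy : y ∈ U) (hM : MSmooth M U)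
    (hN : MSmooth N U) (μ : Fin 4) :
    mpd μ (fun z => M z - N z) y = mpd μ M y - mpd μ N y := by
  ext i j
  exact pd_sub (hM.diff hU hy i j) (hN.diff hU hy i j) μ

theorem mpd_mul [Fintype m] {M : Pt → Matrix l m ℝ} {N : Pt → Matrix m n ℝ} (hU : IsOpen U)
    (hy : y ∈ U) (hM : MSmooth M U) (hN : MSmooth N U) (μ : Fin 4) :
    mpd μ (fun z => M z * N z) y = mpd μ M y * N y + M y * mpd μ N y := by
  ext i j
  simp only [mpd, Matrix.of_apply, Matrix.mul_apply, Matrix.add_apply]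
  rw [pd_sum fun k _ => (hM.diff hU hy i k).fun_mul (hN.diff hU hy k j), ← Finset.sum_add_distrib]
  exact Finset.sum_congr rfl fun k _ => pd_mul (hM.diff hU hy i k) (hN.diff hU hy k j) μ

end MatrixCalculus

/-! ### The second fundamental form and the Gauss equation -/

section Gauss

open Matrix

variable {D : ℕ} (η : Matrix (Fin D) (Fin D) ℝ) (x : Fin D → Pt → ℝ)

/-- The Jacobian matrix `∂_μ x^a`; its columns span the tangent space of the brane. -/
def jac (y : Pt) : Matrix (Fin D) (Fin 4) ℝ := of fun a μ => pd μ (x a) y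

/-- The Christoffel symbols as matrices, `(Γ_l)^κ_μ = g^{κν} ⟨∂_ν x, ∂_l ∂_μ x⟩`. -/
def connection (l : Fin 4) (y : Pt) : Matrix (Fin 4) (Fin 4) ℝ :=
  (inducedMetric η x y)⁻¹ * (jac x y)ᵀ * η * mpd l (jac x) y

/-- The second fundamental form `K_{lμ}^a = ∇_l ∂_μ x^a`, as a matrix in `a` and `μ`. -/
def sff (l : Fin 4) (y : Pt) : Matrix (Fin D) (Fin 4) ℝ :=
  mpd l (jac x) y - jac x y * connection η x l y

/-- The normal projector as a matrix, with both indices raised. -/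
def normalMatrix (y : Pt) : Matrix (Fin D) (Fin D) ℝ :=
  η⁻¹ - jac x y * (inducedMetric η x y)⁻¹ * (jac x y)ᵀ

variable {η x} {U : Set Pt} {y : Pt}

theorem inducedMetric_eq (y : Pt) : inducedMetric η x y = (jac x y)ᵀ * η * jac x y := by
  ext μ ν
  simp only [inducedMetric, jac, mul_apply, of_apply, transpose_apply, Finset.sum_mul]
  rw [Finset.sum_comm]
  exact Finset.sum_congr rfl fun a _ => Finset.sum_congr rfl fun b _ => by ring

theorem normalMatrix_apply (a b : Fin D) (y : Pt) :
    normalMatrix η x y a b = normalProjector η x a b y := by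
  simp only [normalMatrix, normalProjector, jac, Matrix.sub_apply, mul_apply, of_apply,
    transpose_apply, Finset.sum_mul]
  rw [Finset.sum_comm]
  congr 1
  exact Finset.sum_congr rfl fun a _ => Finset.sum_congr rfl fun b _ => by ring

theorem inducedMetric_transpose (hη : η.IsSymm) (y : Pt) :
    (inducedMetric η x y)ᵀ = inducedMetric η x y := by
  simp only [inducedMetric_eq, transpose_mul, transpose_transpose, hη.eq, Matrix.mul_assoc]

theorem inverse_transpose (hη : η.IsSymm) (y : Pt) :
    ((inducedMetric η x y)⁻¹)ᵀ = (inducedMetric η x y)⁻¹ := by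
  rw [transpose_nonsing_inv, inducedMetric_transpose hη]

theorem inverse_comm (hη : η.IsSymm) (y : Pt) (μ ν : Fin 4) :
    (inducedMetric η x y)⁻¹ μ ν = (inducedMetric η x y)⁻¹ ν μ := by
  conv_lhs => rw [← inverse_transpose hη]
  rfl

theorem inverse_mul_metric (hdet : (inducedMetric η x y).det ≠ 0) :
    (inducedMetric η x y)⁻¹ * (jac x y)ᵀ * η * jac x y = 1 := by
  have := nonsing_inv_mul (inducedMetric η x y) (isUnit_iff_ne_zero.2 hdet)
  conv_lhs at this => arg 2; rw [inducedMetric_eq]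
  simpa only [Matrix.mul_assoc] using this

theorem metric_mul_inverse (hdet : (inducedMetric η x y).det ≠ 0) :
    (jac x y)ᵀ * η * jac x y * (inducedMetric η x y)⁻¹ = 1 := by
  have := mul_nonsing_inv (inducedMetric η x y) (isUnit_iff_ne_zero.2 hdet)
  conv_lhs at this => arg 1; rw [inducedMetric_eq]
  exact this

/-- The second fundamental form takes values in the normal space. -/
theorem jac_transpose_mul_sff (hdet : (inducedMetric η x y).det ≠ 0) (l : Fin 4) :
    (jac x y)ᵀ * η * sff η x l y = 0 := by
  have h := metric_mul_inverse hdet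
  have : (jac x y)ᵀ * η * (jac x y * connection η x l y)
      = ((jac x y)ᵀ * η * jac x y * (inducedMetric η x y)⁻¹)
        * ((jac x y)ᵀ * η * mpd l (jac x) y) := by
    simp only [connection, Matrix.mul_assoc]
  rw [sff, Matrix.mul_sub, this, h, Matrix.one_mul, sub_self]

theorem sff_transpose_mul_jac (hη : η.IsSymm) (hdet : (inducedMetric η x y).det ≠ 0)
    (l : Fin 4) : (sff η x l y)ᵀ * η * jac x y = 0 := by
  have h := congrArg transpose (jac_transpose_mul_sff hdet l)
  simpa only [transpose_mul, transpose_transpose, hη.eq, transpose_zero, Matrix.mul_assoc] using h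

theorem jac_transpose_mul_normalMatrix (hη' : η.det ≠ 0)
    (hdet : (inducedMetric η x y).det ≠ 0) : (jac x y)ᵀ * η * normalMatrix η x y = 0 := by
  have h := metric_mul_inverse hdet
  have h2 : (jac x y)ᵀ * η * (jac x y * (inducedMetric η x y)⁻¹ * (jac x y)ᵀ)
      = ((jac x y)ᵀ * η * jac x y * (inducedMetric η x y)⁻¹) * (jac x y)ᵀ := by
    simp only [Matrix.mul_assoc]
  rw [normalMatrix, Matrix.mul_sub, h2, h, Matrix.one_mul, Matrix.mul_assoc,
    mul_nonsing_inv η (isUnit_iff_ne_zero.2 hη'), Matrix.mul_one, sub_self]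

theorem normalMatrix_transpose (hη : η.IsSymm) (y : Pt) :
    (normalMatrix η x y)ᵀ = normalMatrix η x y := by
  simp only [normalMatrix, transpose_sub, transpose_mul, transpose_transpose,
    transpose_nonsing_inv η, hη.eq, inverse_transpose hη, Matrix.mul_assoc]

/-- `tr(P_N η P_N η) = tr(P_N η) = D - 4`: the rank of the normal projector. -/
theorem trace_normalMatrix_sq (hη' : η.det ≠ 0) (hdet : (inducedMetric η x y).det ≠ 0) :
    (normalMatrix η x y * η * normalMatrix η x y * η).trace = (D : ℝ) - 4 := by
  have h1 : normalMatrix η x y * η * normalMatrix η x y = normalMatrix η x y := by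
    conv_lhs => arg 1; arg 1; rw [normalMatrix]
    have := jac_transpose_mul_normalMatrix hη' hdet
    rw [Matrix.sub_mul, Matrix.sub_mul, nonsing_inv_mul η (isUnit_iff_ne_zero.2 hη'),
      Matrix.one_mul]
    simp only [Matrix.mul_assoc] at this ⊢
    simp [this]
  rw [h1, normalMatrix, Matrix.sub_mul, trace_sub, nonsing_inv_mul η (isUnit_iff_ne_zero.2 hη'),
    Matrix.mul_assoc, Matrix.mul_assoc, trace_mul_comm]
  simp only [← Matrix.mul_assoc]
  rw [inverse_mul_metric hdet]
  simp

theorem jac_smooth (hU : IsOpen U) (hx : ∀ a, ContDiffOn ℝ ∞ (x a) U) : MSmooth (jac x) U :=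
  fun a μ => contDiffOn_pd hU (hx a) μ

theorem metric_smooth (hU : IsOpen U) (hx : ∀ a, ContDiffOn ℝ ∞ (x a) U) :
    MSmooth (inducedMetric η x) U := by
  have : inducedMetric η x = fun z => (jac x z)ᵀ * η * jac x z := funext inducedMetric_eq
  rw [this]
  exact ((jac_smooth hU hx).transpose.mul (MSmooth.const η)).mul (jac_smooth hU hx)

theorem inverse_smooth (hU : IsOpen U) (hx : ∀ a, ContDiffOn ℝ ∞ (x a) U)
    (hdet : ∀ z ∈ U, (inducedMetric η x z).det ≠ 0) :
    MSmooth (fun z => (inducedMetric η x z)⁻¹) U :=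
  (metric_smooth hU hx).inv hdet

theorem connection_smooth (hU : IsOpen U) (hx : ∀ a, ContDiffOn ℝ ∞ (x a) U)
    (hdet : ∀ z ∈ U, (inducedMetric η x z).det ≠ 0) (l : Fin 4) :
    MSmooth (connection η x l) U :=
  (((inverse_smooth hU hx hdet).mul (jac_smooth hU hx).transpose).mul (MSmooth.const η)).mul
    ((jac_smooth hU hx).mpd hU l)

theorem sff_smooth (hU : IsOpen U) (hx : ∀ a, ContDiffOn ℝ ∞ (x a) U)
    (hdet : ∀ z ∈ U, (inducedMetric η x z).det ≠ 0) (l : Fin 4) : MSmooth (sff η x l) U :=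
  ((jac_smooth hU hx).mpd hU l).sub ((jac_smooth hU hx).mul (connection_smooth hU hx hdet l))

theorem normalMatrix_smooth (hU : IsOpen U) (hx : ∀ a, ContDiffOn ℝ ∞ (x a) U)
    (hdet : ∀ z ∈ U, (inducedMetric η x z).det ≠ 0) : MSmooth (normalMatrix η x) U :=
  (MSmooth.const η⁻¹).sub
    (((jac_smooth hU hx).mul (inverse_smooth hU hx hdet)).mul (jac_smooth hU hx).transpose)

theorem mpd_jac_comm (hU : IsOpen U) (hx : ∀ a, ContDiffOn ℝ ∞ (x a) U) (hy : y ∈ U)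
    (l μ : Fin 4) (a : Fin D) : mpd l (jac x) y a μ = mpd μ (jac x) y a l :=
  pd_comm hU (hx a) hy l μ

theorem connection_symm (hU : IsOpen U) (hx : ∀ a, ContDiffOn ℝ ∞ (x a) U) (hy : y ∈ U)
    (l μ κ : Fin 4) : connection η x l y κ μ = connection η x μ y κ l := by
  simp only [connection, mul_apply (N := mpd _ _ _), mpd_jac_comm hU hx hy l μ]

theorem sff_symm (hU : IsOpen U) (hx : ∀ a, ContDiffOn ℝ ∞ (x a) U) (hy : y ∈ U)
    (l μ : Fin 4) (a : Fin D) : sff η x l y a μ = sff η x μ y a l := by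
  simp only [sff, Matrix.sub_apply, mul_apply (M := jac x y), mpd_jac_comm hU hx hy l μ,
    connection_symm hU hx hy l μ]

theorem mpd_metric (hU : IsOpen U) (hx : ∀ a, ContDiffOn ℝ ∞ (x a) U) (hy : y ∈ U) (l : Fin 4) :
    mpd l (inducedMetric η x) y
      = (mpd l (jac x) y)ᵀ * η * jac x y + (jac x y)ᵀ * η * mpd l (jac x) y := by
  have hE := jac_smooth hU hx
  rw [mpd_congr hU hy (fun z _ => inducedMetric_eq z) l,
    mpd_mul hU hy (hE.transpose.mul (MSmooth.const η)) hE,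
    mpd_mul hU hy hE.transpose (MSmooth.const η), mpd_transpose, mpd_const, Matrix.mul_zero,
    add_zero]

theorem mpd_inverse (hU : IsOpen U) (hx : ∀ a, ContDiffOn ℝ ∞ (x a) U) (hy : y ∈ U)
    (hdet : ∀ z ∈ U, (inducedMetric η x z).det ≠ 0) (l : Fin 4) :
    mpd l (fun z => (inducedMetric η x z)⁻¹) y
      = -((inducedMetric η x y)⁻¹ * mpd l (inducedMetric η x) y * (inducedMetric η x y)⁻¹) := by
  have h0 := mpd_congr hU hy (M := fun z => (inducedMetric η x z)⁻¹ * inducedMetric η x z)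
    (N := fun _ => 1)
    (fun z hz => nonsing_inv_mul _ (isUnit_iff_ne_zero.2 (hdet z hz))) l
  rw [mpd_mul hU hy (inverse_smooth hU hx hdet) (metric_smooth hU hx), mpd_const] at h0
  have h1 := congrArg (· * (inducedMetric η x y)⁻¹) (eq_neg_of_add_eq_zero_left h0)
  simpa only [Matrix.mul_assoc, mul_nonsing_inv _ (isUnit_iff_ne_zero.2 (hdet y hy)),
    Matrix.mul_one, Matrix.neg_mul] using h1

/-- The normal projector varies through the second fundamental form only:
`∂_l P_N^{ab} = -g^{μν} (K_{lμ}^a ∂_ν x^b + ∂_μ x^a K_{lν}^b)`. -/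
theorem mpd_normalMatrix (hη : η.IsSymm) (hU : IsOpen U) (hx : ∀ a, ContDiffOn ℝ ∞ (x a) U)
    (hy : y ∈ U) (hdet : ∀ z ∈ U, (inducedMetric η x z).det ≠ 0) (l : Fin 4) :
    mpd l (normalMatrix η x) y
      = -(sff η x l y * (inducedMetric η x y)⁻¹ * (jac x y)ᵀ
        + jac x y * (inducedMetric η x y)⁻¹ * (sff η x l y)ᵀ) := by
  have hE := jac_smooth hU hx
  have hh := inverse_smooth hU hx hdet
  have : normalMatrix η x
      = fun z => η⁻¹ - jac x z * (inducedMetric η x z)⁻¹ * (jac x z)ᵀ := rfl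
  rw [this, mpd_sub hU hy (MSmooth.const _) ((hE.mul hh).mul hE.transpose), mpd_const,
    mpd_mul hU hy (hE.mul hh) hE.transpose, mpd_mul hU hy hE hh, mpd_inverse hU hx hy hdet,
    mpd_metric hU hx hy, mpd_transpose]
  simp only [sff, connection, transpose_sub, transpose_mul, transpose_transpose, hη.eq,
    inverse_transpose hη, Matrix.mul_assoc, Matrix.sub_mul, Matrix.mul_sub, Matrix.add_mul,
    Matrix.mul_add, Matrix.mul_neg, Matrix.neg_mul]
  abel

theorem christoffel_eq (hU : IsOpen U) (hx : ∀ a, ContDiffOn ℝ ∞ (x a) U)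
    (hη : η.IsSymm) (hy : y ∈ U) (κ l μ : Fin 4) :
    christoffel (inducedMetric η x) κ l μ y = connection η x l y κ μ := by
  have hb : ∀ α β γ, ((jac x y)ᵀ * η * mpd α (jac x) y) β γ
      = ((jac x y)ᵀ * η * mpd γ (jac x) y) β α := fun α β γ => by
    simp only [mul_apply (N := mpd _ _ _), mpd_jac_comm hU hx hy α γ]
  have hg : ∀ α β γ, pd α (fun z => inducedMetric η x z β γ) y
      = ((jac x y)ᵀ * η * mpd α (jac x) y) γ β + ((jac x y)ᵀ * η * mpd α (jac x) y) β γ := by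
    intro α β γ
    have h1 : pd α (fun z => inducedMetric η x z β γ) y = mpd α (inducedMetric η x) y β γ := rfl
    have h2 : (mpd α (jac x) y)ᵀ * η * jac x y = ((jac x y)ᵀ * η * mpd α (jac x) y)ᵀ := by
      simp only [transpose_mul, transpose_transpose, hη.eq, Matrix.mul_assoc]
    rw [h1, mpd_metric hU hx hy, h2, Matrix.add_apply, transpose_apply]
  have hc : connection η x l y
      = (inducedMetric η x y)⁻¹ * ((jac x y)ᵀ * η * mpd l (jac x) y) := by
    simp only [connection, Matrix.mul_assoc]
  rw [hc, mul_apply, christoffel, Finset.mul_sum]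
  refine Finset.sum_congr rfl fun ν _ => ?_
  rw [hg, hg, hg, hb μ l ν, hb μ ν l, hb ν μ l]
  ring

/-- The Gauss equation in matrix form: the curvature `∂_l Γ_ν - ∂_ν Γ_l + [Γ_l, Γ_ν]` of the
induced connection. It follows from the symmetry of the third derivatives of `x`, projected on
the tangent space. -/
theorem gauss_equation (hU : IsOpen U) (hx : ∀ a, ContDiffOn ℝ ∞ (x a) U)
    (hy : y ∈ U) (hdet : ∀ z ∈ U, (inducedMetric η x z).det ≠ 0) (l ν : Fin 4) :
    mpd l (connection η x ν) y - mpd ν (connection η x l) y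
        + connection η x l y * connection η x ν y - connection η x ν y * connection η x l y
      = (inducedMetric η x y)⁻¹ * ((sff η x l y)ᵀ * η * sff η x ν y
        - (sff η x ν y)ᵀ * η * sff η x l y) := by
  have hE := jac_smooth hU hx
  -- The tangential part of the derivative of the second fundamental form.
  have hK : ∀ α β, (jac x y)ᵀ * η * mpd α (sff η x β) y
      = -((sff η x α y)ᵀ * η * sff η x β y) := by
    intro α β
    have h0 := mpd_congr hU hy (M := fun z => (jac x z)ᵀ * η * sff η x β z) (N := fun _ => 0)
      (fun z hz => jac_transpose_mul_sff (hdet z hz) β) α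
    rw [mpd_mul hU hy (hE.transpose.mul (MSmooth.const η)) (sff_smooth hU hx hdet β),
      mpd_mul hU hy hE.transpose (MSmooth.const η), mpd_transpose, mpd_const, Matrix.mul_zero,
      add_zero, mpd_const] at h0
    have h1 : mpd α (jac x) y = sff η x α y + jac x y * connection η x α y := by simp [sff]
    have h2 := jac_transpose_mul_sff (hdet y hy) β
    rw [Matrix.mul_assoc] at h2
    rw [h1, transpose_add, transpose_mul, Matrix.add_mul, Matrix.add_mul,
      Matrix.mul_assoc (_ * _) η, Matrix.mul_assoc _ _ (η * _), h2, Matrix.mul_zero,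
      add_zero] at h0
    exact eq_neg_of_add_eq_zero_right h0
  -- Differentiating `∂_β ∂x = K_β + ∂x Γ_β` and projecting on the tangent space.
  have hA : ∀ α β, (inducedMetric η x y)⁻¹ * (jac x y)ᵀ * η * mpd α (mpd β (jac x)) y
      = -((inducedMetric η x y)⁻¹ * ((sff η x α y)ᵀ * η * sff η x β y))
        + connection η x α y * connection η x β y + mpd α (connection η x β) y := by
    intro α β
    have h0 := mpd_congr hU hy (M := mpd β (jac x))
      (N := fun z => sff η x β z - (fun z => (0 : Matrix (Fin D) (Fin 4) ℝ)
        - jac x z * connection η x β z) z) (fun z hz => by simp [sff]) α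
    rw [mpd_sub hU hy (sff_smooth hU hx hdet β) ((MSmooth.const 0).sub
        (hE.mul (connection_smooth hU hx hdet β))), mpd_sub hU hy (MSmooth.const 0)
        (hE.mul (connection_smooth hU hx hdet β)), mpd_const,
        mpd_mul hU hy hE (connection_smooth hU hx hdet β), zero_sub, sub_neg_eq_add] at h0
    rw [h0, Matrix.mul_add, Matrix.mul_add, ← Matrix.mul_assoc _ (mpd α (jac x) y),
      ← Matrix.mul_assoc _ (jac x y), inverse_mul_metric (hdet y hy), Matrix.one_mul]
    have h3 : (inducedMetric η x y)⁻¹ * (jac x y)ᵀ * η * mpd α (sff η x β) y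
        = (inducedMetric η x y)⁻¹ * ((jac x y)ᵀ * η * mpd α (sff η x β) y) := by
      simp only [Matrix.mul_assoc]
    rw [h3, hK, Matrix.mul_neg, ← add_assoc]
    rfl
  have hS : mpd l (mpd ν (jac x)) y = mpd ν (mpd l (jac x)) y := by
    ext a μ
    exact pd_comm hU (hE a μ) hy l ν
  have h1 := hA l ν
  rw [hS, hA ν l] at h1
  rw [Matrix.mul_sub]
  rw [← sub_eq_zero] at h1 ⊢
  rw [← neg_eq_zero, ← h1]
  abel

/-- The contracted Gauss equation, `R = ⟨K^μ_μ, K^ν_ν⟩ - ⟨K_{μν}, K^{μν}⟩`. -/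
theorem scalarCurvature_eq (hη : η.IsSymm) (hU : IsOpen U) (hx : ∀ a, ContDiffOn ℝ ∞ (x a) U)
    (hy : y ∈ U) (hdet : ∀ z ∈ U, (inducedMetric η x z).det ≠ 0) :
    scalarCurvature (inducedMetric η x) y
      = ∑ μ, ∑ ν, ∑ l, ∑ α, (inducedMetric η x y)⁻¹ μ ν * (inducedMetric η x y)⁻¹ l α *
        (((sff η x l y)ᵀ * η * sff η x ν y) α μ - ((sff η x ν y)ᵀ * η * sff η x l y) α μ) := by
  refine Finset.sum_congr rfl fun μ _ => Finset.sum_congr rfl fun ν _ => ?_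
  simp only [mul_assoc, ← Finset.mul_sum]
  congr 1
  have hd : ∀ α κ β γ, pd α (christoffel (inducedMetric η x) κ β γ) y
      = mpd α (connection η x β) y κ γ := fun α κ β γ =>
    pd_congr hU hy (fun z hz => christoffel_eq hU hx hη hz κ β γ) α
  rw [ricci, ← Finset.sum_add_distrib]
  refine Finset.sum_congr rfl fun l _ => ?_
  have h := congrFun (congrFun (gauss_equation hU hx hy hdet l ν) l) μ
  simp only [Matrix.sub_apply, Matrix.add_apply, mul_apply (M := connection η x _ y),
    mul_apply (M := (inducedMetric η x y)⁻¹)] at h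
  rw [← h]
  simp only [hd, christoffel_eq hU hx hη hy, Finset.sum_sub_distrib]
  have e1 : mpd l (connection η x μ) y l ν = mpd l (connection η x ν) y l μ :=
    pd_congr hU hy (fun z hz => connection_symm hU hx hz μ ν l) l
  have e2 : ∀ κ, connection η x μ y κ ν = connection η x ν y κ μ :=
    fun κ => connection_symm hU hx hy μ ν κ
  simp only [e1, e2]
  ring

end Gauss

/-! ### Gradient and divergence terms of the rescaled normal projector -/

section NormalTerms

open Matrix

variable {D : ℕ} {η : Matrix (Fin D) (Fin D) ℝ} {x : Fin D → Pt → ℝ} {U : Set Pt} {y : Pt}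

theorem trace_mpd_normalMatrix_sq (hη : η.IsSymm) (hU : IsOpen U)
    (hx : ∀ a, ContDiffOn ℝ ∞ (x a) U) (hy : y ∈ U)
    (hdet : ∀ z ∈ U, (inducedMetric η x z).det ≠ 0) (μ ν : Fin 4) :
    (mpd μ (normalMatrix η x) y * η * mpd ν (normalMatrix η x) y * η).trace
      = ((inducedMetric η x y)⁻¹ * ((sff η x ν y)ᵀ * η * sff η x μ y)).trace
        + ((inducedMetric η x y)⁻¹ * ((sff η x μ y)ᵀ * η * sff η x ν y)).trace := by
  have h1 := metric_mul_inverse (hdet y hy)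
  have h2 := jac_transpose_mul_sff (hdet y hy) ν
  have h3 := sff_transpose_mul_jac hη (hdet y hy) μ
  rw [mpd_normalMatrix hη hU hx hy hdet, mpd_normalMatrix hη hU hx hy hdet]
  generalize (inducedMetric η x y)⁻¹ = h at *
  generalize sff η x ν y = K' at *
  generalize sff η x μ y = K at *
  generalize jac x y = E at *
  have e : -(K * h * Eᵀ + E * h * Kᵀ) * η * -(K' * h * Eᵀ + E * h * K'ᵀ) * η
      = K * h * (Eᵀ * η * K') * h * Eᵀ * η + K * h * (Eᵀ * η * E * h) * K'ᵀ * η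
        + (E * h * (Kᵀ * η * K') * h) * (Eᵀ * η)
        + E * h * (Kᵀ * η * E) * h * K'ᵀ * η := by
    simp only [Matrix.neg_mul, Matrix.mul_neg, Matrix.mul_add, Matrix.add_mul,
      Matrix.mul_assoc]
    abel
  rw [e, h1, h2, h3]
  simp only [Matrix.mul_zero, Matrix.zero_mul, zero_add, add_zero, Matrix.mul_one, trace_add]
  congr 1
  · rw [Matrix.mul_assoc, Matrix.mul_assoc, trace_mul_comm]
    simp only [Matrix.mul_assoc]
  · have e2 : E * h * (Kᵀ * η * K') * h * (Eᵀ * η) = E * (h * (Kᵀ * η * K') * h * (Eᵀ * η)) := by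
      simp only [Matrix.mul_assoc]
    rw [e2, trace_mul_comm, Matrix.mul_assoc _ _ E, Matrix.mul_assoc _ h, Matrix.mul_assoc h,
      trace_mul_comm, Matrix.mul_assoc _ (h * _)]
    have e3 : h * (Eᵀ * η * E) = 1 := mul_eq_one_comm.1 h1
    rw [e3, Matrix.one_mul, trace_mul_comm]

theorem trace_normalMatrix_mul_mpd (hη : η.IsSymm) (hη' : η.det ≠ 0) (hU : IsOpen U)
    (hx : ∀ a, ContDiffOn ℝ ∞ (x a) U) (hy : y ∈ U)
    (hdet : ∀ z ∈ U, (inducedMetric η x z).det ≠ 0) (ν : Fin 4) :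
    (normalMatrix η x y * η * mpd ν (normalMatrix η x) y * η).trace = 0 := by
  have h1 := jac_transpose_mul_normalMatrix hη' (hdet y hy)
  have h2 : normalMatrix η x y * η * jac x y = 0 := by
    have := congrArg transpose h1
    simpa only [transpose_mul, transpose_transpose, hη.eq, normalMatrix_transpose hη,
      transpose_zero, Matrix.mul_assoc] using this
  rw [mpd_normalMatrix hη hU hx hy hdet]
  generalize (inducedMetric η x y)⁻¹ = h at *
  generalize sff η x ν y = K at *
  generalize normalMatrix η x y = N at *
  generalize jac x y = E at *
  have e : N * η * -(K * h * Eᵀ + E * h * Kᵀ) * η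
      = -(N * (η * (K * h * (Eᵀ * η))) + (N * η * E) * h * Kᵀ * η) := by
    simp only [Matrix.mul_neg, Matrix.neg_mul, Matrix.mul_add, Matrix.add_mul, Matrix.mul_assoc]
  rw [e, h2, trace_neg, trace_add, trace_mul_comm N, Matrix.mul_assoc η, Matrix.mul_assoc (K * h),
    h1]
  simp

theorem mpd_smul {s : Pt → ℝ} {M : Pt → Matrix (Fin D) (Fin D) ℝ} (hU : IsOpen U) (hy : y ∈ U)
    (hs : ContDiffOn ℝ ∞ s U) (hM : MSmooth M U) (μ : Fin 4) :
    mpd μ (fun z => s z • M z) y = pd μ s y • M y + s y • mpd μ M y := by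
  ext i j
  exact pd_mul (differentiableAt_of_contDiffOn hU hs hy) (hM.diff hU hy i j) μ

/-- The squared gradient of `s P_N`. The cross terms vanish because `P_N` is a projector of
constant rank. -/
theorem gradient_sq_smul_normalMatrix (hη : η.IsSymm) (hη' : η.det ≠ 0) (hU : IsOpen U)
    (hx : ∀ a, ContDiffOn ℝ ∞ (x a) U) (hy : y ∈ U)
    (hdet : ∀ z ∈ U, (inducedMetric η x z).det ≠ 0) {s : Pt → ℝ} (hs : ContDiffOn ℝ ∞ s U) :
    ∑ μ, ∑ ν, (inducedMetric η x y)⁻¹ μ ν *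
        (mpd μ (fun z => s z • normalMatrix η x z) y * η
          * mpd ν (fun z => s z • normalMatrix η x z) y * η).trace
      = ((D : ℝ) - 4) * ∑ μ, ∑ ν, (inducedMetric η x y)⁻¹ μ ν * (pd μ s y * pd ν s y)
        + 2 * s y ^ 2 * ∑ μ, ∑ ν, ∑ l, ∑ α, (inducedMetric η x y)⁻¹ μ ν *
          (inducedMetric η x y)⁻¹ l α * ((sff η x ν y)ᵀ * η * sff η x l y) α μ := by
  have hN := normalMatrix_smooth hU hx hdet
  have hterm : ∀ μ ν, (mpd μ (fun z => s z • normalMatrix η x z) y * η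
          * mpd ν (fun z => s z • normalMatrix η x z) y * η).trace
      = ((D : ℝ) - 4) * (pd μ s y * pd ν s y)
        + s y ^ 2 * (mpd μ (normalMatrix η x) y * η * mpd ν (normalMatrix η x) y * η).trace := by
    intro μ ν
    have c1 := trace_normalMatrix_mul_mpd hη hη' hU hx hy hdet ν
    have c2 : (mpd μ (normalMatrix η x) y * η * normalMatrix η x y * η).trace = 0 := by
      rw [← trace_normalMatrix_mul_mpd hη hη' hU hx hy hdet μ, Matrix.mul_assoc, trace_mul_comm]
      simp only [Matrix.mul_assoc]
    have c3 := trace_normalMatrix_sq (x := x) hη' (hdet y hy)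
    rw [mpd_smul hU hy hs hN, mpd_smul hU hy hs hN]
    simp only [Matrix.add_mul, Matrix.mul_add, Matrix.smul_mul, Matrix.mul_smul, trace_add,
      trace_smul, smul_eq_mul, c1, c2, c3]
    ring
  have hK : ∀ μ ν, (mpd μ (normalMatrix η x) y * η * mpd ν (normalMatrix η x) y * η).trace
      = 2 * ∑ l, ∑ α, (inducedMetric η x y)⁻¹ l α
        * ((sff η x ν y)ᵀ * η * sff η x l y) α μ := by
    intro μ ν
    have ht : ((inducedMetric η x y)⁻¹ * ((sff η x μ y)ᵀ * η * sff η x ν y)).trace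
        = ((inducedMetric η x y)⁻¹ * ((sff η x ν y)ᵀ * η * sff η x μ y)).trace := by
      rw [← trace_transpose, transpose_mul, trace_mul_comm]
      simp only [transpose_mul, transpose_transpose, hη.eq, inverse_transpose hη,
        Matrix.mul_assoc]
    have hs : ∀ l α, ((sff η x ν y)ᵀ * η * sff η x μ y) α l
        = ((sff η x ν y)ᵀ * η * sff η x l y) α μ := fun l α => by
      simp only [mul_apply (N := sff η x _ y), sff_symm hU hx hy μ l]
    rw [trace_mpd_normalMatrix_sq hη hU hx hy hdet, ht, ← two_mul]
    simp only [trace, diag_apply, mul_apply (M := (inducedMetric η x y)⁻¹), hs]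
  simp only [hterm, hK, mul_add, Finset.sum_add_distrib]
  congr 1
  · simp only [Finset.mul_sum]
    exact Finset.sum_congr rfl fun μ _ => Finset.sum_congr rfl fun ν _ => by ring
  · simp only [Finset.mul_sum]
    exact Finset.sum_congr rfl fun μ _ => Finset.sum_congr rfl fun ν _ =>
      Finset.sum_congr rfl fun l _ => Finset.sum_congr rfl fun α _ => by ring

theorem sqrtDet_smooth {h : Pt → Matrix (Fin 4) (Fin 4) ℝ} (hh : MSmooth h U)
    (hdet : ∀ z ∈ U, (h z).det ≠ 0) : ContDiffOn ℝ ∞ (sqrtDet h) U := by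
  intro z hz
  exact ((hh.det z hz).abs (hdet z hz)).sqrt (abs_ne_zero.2 (hdet z hz))

theorem sqrtDet_pos {h : Pt → Matrix (Fin 4) (Fin 4) ℝ} (hdet : (h y).det ≠ 0) :
    0 < sqrtDet h y := Real.sqrt_pos.2 (abs_pos.2 hdet)

/-- The Laplace-Beltrami operator is `g^{μν} ∂_μ ∂_ν` up to a first-order operator. -/
theorem laplaceBeltrami_eq {h : Pt → Matrix (Fin 4) (Fin 4) ℝ} (hU : IsOpen U) (hy : y ∈ U)
    (hh : MSmooth h U) (hdet : ∀ z ∈ U, (h z).det ≠ 0) {f : Pt → ℝ} (hf : ContDiffOn ℝ ∞ f U) :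
    laplaceBeltrami h f y
      = ∑ ν, (∑ μ, (sqrtDet h y)⁻¹ * pd μ (fun z => sqrtDet h z * (h z)⁻¹ μ ν) y) * pd ν f y
        + ∑ μ, ∑ ν, (h y)⁻¹ μ ν * pd μ (pd ν f) y := by
  have hv : ∀ μ ν, ContDiffOn ℝ ∞ (fun z => sqrtDet h z * (h z)⁻¹ μ ν) U :=
    fun μ ν => (sqrtDet_smooth hh hdet).mul (hh.inv hdet μ ν)
  have hp : sqrtDet h y ≠ 0 := (sqrtDet_pos (hdet y hy)).ne'
  have hterm : ∀ μ, pd μ (fun z => ∑ ν, sqrtDet h z * (h z)⁻¹ μ ν * pd ν f z) y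
      = ∑ ν, (pd μ (fun z => sqrtDet h z * (h z)⁻¹ μ ν) y * pd ν f y
        + sqrtDet h y * (h y)⁻¹ μ ν * pd μ (pd ν f) y) := by
    intro μ
    rw [pd_sum fun ν _ => (differentiableAt_of_contDiffOn hU (hv μ ν) hy).fun_mul
      (differentiableAt_of_contDiffOn hU (contDiffOn_pd hU hf ν) hy)]
    exact Finset.sum_congr rfl fun ν _ => pd_mul (differentiableAt_of_contDiffOn hU (hv μ ν) hy)
      (differentiableAt_of_contDiffOn hU (contDiffOn_pd hU hf ν) hy) μ
  simp only [laplaceBeltrami, hterm, Finset.sum_add_distrib, mul_add, Finset.mul_sum,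
    Finset.sum_mul]
  congr 1
  · rw [Finset.sum_comm]
    exact Finset.sum_congr rfl fun μ _ => Finset.sum_congr rfl fun ν _ => by ring
  · refine Finset.sum_congr rfl fun μ _ => Finset.sum_congr rfl fun ν _ => ?_
    field_simp

/-- The normal part of `□_g x` is the trace `g^{μν} K_{μν}` of the second fundamental form. -/
theorem normalMatrix_laplaceBeltrami (hη : η.IsSymm) (hη' : η.det ≠ 0) (hU : IsOpen U)
    (hx : ∀ a, ContDiffOn ℝ ∞ (x a) U) (hy : y ∈ U)
    (hdet : ∀ z ∈ U, (inducedMetric η x z).det ≠ 0) (v : Fin D → ℝ)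
    (hv : ∀ a, v a = laplaceBeltrami (inducedMetric η x) (x a) y) :
    (η *ᵥ v) ⬝ᵥ (normalMatrix η x y *ᵥ (η *ᵥ v))
      = ∑ μ, ∑ ν, ∑ l, ∑ α, (inducedMetric η x y)⁻¹ μ ν * (inducedMetric η x y)⁻¹ l α *
        ((sff η x l y)ᵀ * η * sff η x ν y) α μ := by
  set k : Fin D → ℝ := fun a => ∑ μ, ∑ ν, (inducedMetric η x y)⁻¹ μ ν * sff η x ν y a μ with hk
  obtain ⟨d, hd⟩ : ∃ d : Fin 4 → ℝ, v = jac x y *ᵥ d + k := by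
    refine ⟨fun κ => (∑ μ, (sqrtDet (inducedMetric η x) y)⁻¹ *
      pd μ (fun z => sqrtDet (inducedMetric η x) z * (inducedMetric η x z)⁻¹ μ κ) y)
      + ∑ μ, ∑ ν, (inducedMetric η x y)⁻¹ μ ν * connection η x ν y κ μ, ?_⟩
    funext a
    have h1 : ∀ μ ν, pd μ (pd ν (x a)) y
        = sff η x ν y a μ + ∑ κ, jac x y a κ * connection η x ν y κ μ := by
      intro μ ν
      rw [pd_comm hU (hx a) hy, ← mul_apply, ← Matrix.add_apply, sff, sub_add_cancel]
      rfl
    have h2 : ∀ κ, pd κ (x a) y = jac x y a κ := fun κ => rfl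
    rw [hv, laplaceBeltrami_eq hU hy (metric_smooth hU hx) hdet (hx a)]
    simp only [h1, h2, hk, Pi.add_apply, mulVec, dotProduct, mul_add, Finset.sum_add_distrib]
    have h3 : ∑ μ, ∑ ν, (inducedMetric η x y)⁻¹ μ ν
          * ∑ κ, jac x y a κ * connection η x ν y κ μ
        = ∑ κ, jac x y a κ * ∑ μ, ∑ ν, (inducedMetric η x y)⁻¹ μ ν * connection η x ν y κ μ := by
      simp only [Finset.mul_sum]
      conv_rhs => rw [Finset.sum_comm]
      refine Finset.sum_congr rfl fun μ _ => ?_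
      rw [Finset.sum_comm]
      exact Finset.sum_congr rfl fun κ _ => Finset.sum_congr rfl fun ν _ => by ring
    rw [h3]
    simp only [mul_comm (jac x y a _)]
    ring
  have h0 : k = ∑ ν, sff η x ν y *ᵥ fun μ => (inducedMetric η x y)⁻¹ μ ν := by
    funext a
    simp only [hk, Finset.sum_apply, mulVec, dotProduct]
    rw [Finset.sum_comm]
    simp only [mul_comm]
  have hKk : ((jac x y)ᵀ * η) *ᵥ k = 0 := by
    rw [h0, mulVec_sum]
    simp only [mulVec_mulVec, jac_transpose_mul_sff (hdet y hy), zero_mulVec,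
      Finset.sum_const_zero]
  have hNv : normalMatrix η x y *ᵥ (η *ᵥ v) = k := by
    have h2 : normalMatrix η x y * η * jac x y = 0 := by
      have := congrArg transpose (jac_transpose_mul_normalMatrix (x := x) hη' (hdet y hy))
      simpa only [transpose_mul, transpose_transpose, hη.eq, normalMatrix_transpose hη,
        transpose_zero, Matrix.mul_assoc] using this
    have h3 : normalMatrix η x y * η
        = 1 - jac x y * (inducedMetric η x y)⁻¹ * ((jac x y)ᵀ * η) := by
      rw [normalMatrix, Matrix.sub_mul, nonsing_inv_mul η (isUnit_iff_ne_zero.2 hη'),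
        Matrix.mul_assoc]
    rw [mulVec_mulVec, hd, mulVec_add, mulVec_mulVec, h2, zero_mulVec, zero_add, h3, sub_mulVec,
      one_mulVec, ← mulVec_mulVec, hKk, mulVec_zero, sub_zero]
  have hvk : (η *ᵥ v) ⬝ᵥ k = (η *ᵥ k) ⬝ᵥ k := by
    have h4 : (η *ᵥ (jac x y *ᵥ d)) ⬝ᵥ k = d ⬝ᵥ (((jac x y)ᵀ * η) *ᵥ k) := by
      rw [mulVec_mulVec, dotProduct_mulVec, ← mulVec_transpose, transpose_mul,
        transpose_transpose, hη.eq]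
    rw [hd, mulVec_add, add_dotProduct, h4, hKk, dotProduct_zero, zero_add]
  have hQ : ∀ l ν, (sff η x l y *ᵥ fun μ => (inducedMetric η x y)⁻¹ μ l)
        ⬝ᵥ ((η * sff η x ν y) *ᵥ fun μ => (inducedMetric η x y)⁻¹ μ ν)
      = ∑ α, ∑ μ, (inducedMetric η x y)⁻¹ μ ν * (inducedMetric η x y)⁻¹ l α *
        ((sff η x l y)ᵀ * η * sff η x ν y) α μ := by
    intro l ν
    rw [dotProduct_comm, dotProduct_mulVec, ← mulVec_transpose, mulVec_mulVec, dotProduct_comm,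
      ← Matrix.mul_assoc]
    simp only [dotProduct, mulVec, Finset.mul_sum, inverse_comm hη y l]
    exact Finset.sum_congr rfl fun α _ => Finset.sum_congr rfl fun μ _ => by ring
  rw [hNv, hvk, dotProduct_comm, h0, mulVec_sum, sum_dotProduct]
  simp only [dotProduct_sum, mulVec_mulVec, hQ]
  rw [Finset.sum_comm]
  conv_rhs => rw [Finset.sum_comm]
  refine Finset.sum_congr rfl fun ν _ => ?_
  conv_rhs => rw [Finset.sum_comm]
  refine Finset.sum_congr rfl fun l _ => ?_
  rw [Finset.sum_comm]

end NormalTerms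

/-! ### The Poisson bracket and the Liouville density -/

section Poisson

open Matrix

variable {D : ℕ} {η : Matrix (Fin D) (Fin D) ℝ} {x : Fin D → Pt → ℝ} {U : Set Pt} {y : Pt}
  {θ : Pt → Matrix (Fin 4) (Fin 4) ℝ}

/-- The Jacobi identity contracted with the dual tensor `½ ε_{κλμν} θ^{μν}`: it says
`∂_μ θ^{μν} = θ^{μν} ∂_μ log p`, with `p` the Pfaffian of `θ`. Here `d l μ ν` stands for
`∂_l θ^{μν}`. -/
theorem pfaffian_mul_divergence {t : Matrix (Fin 4) (Fin 4) ℝ} {d : Fin 4 → Fin 4 → Fin 4 → ℝ}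
    (ht : ∀ μ ν, t μ ν = -t ν μ) (hd : ∀ l μ ν, d l μ ν = -d l ν μ)
    (hJ : ∀ μ ν κ, ∑ l, (t μ l * d l ν κ + t ν l * d l κ μ + t κ l * d l μ ν) = 0) (ν : Fin 4) :
    (t 0 1 * t 2 3 - t 0 2 * t 1 3 + t 0 3 * t 1 2) * ∑ μ, d μ μ ν
      = ∑ μ, t μ ν * (d μ 0 1 * t 2 3 + t 0 1 * d μ 2 3 - (d μ 0 2 * t 1 3 + t 0 2 * d μ 1 3)
        + (d μ 0 3 * t 1 2 + t 0 3 * d μ 1 2)) := by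
  have t0 : ∀ μ, t μ μ = 0 := fun μ => by linarith [ht μ μ]
  have d0 : ∀ l μ, d l μ μ = 0 := fun l μ => by linarith [hd l μ μ]
  have t10 := ht 1 0
  have t20 := ht 2 0
  have t30 := ht 3 0
  have t21 := ht 2 1
  have t31 := ht 3 1
  have t32 := ht 3 2
  have d10 := fun l => hd l 1 0
  have d20 := fun l => hd l 2 0
  have d30 := fun l => hd l 3 0
  have d21 := fun l => hd l 2 1
  have d31 := fun l => hd l 3 1
  have d32 := fun l => hd l 3 2
  have h1 := hJ ν 0 1
  have h2 := hJ ν 0 2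
  have h3 := hJ ν 0 3
  have h4 := hJ ν 1 2
  have h5 := hJ ν 1 3
  have h6 := hJ ν 2 3
  clear hJ ht hd
  simp only [Fin.sum_univ_four] at *
  fin_cases ν <;>
  · simp only [Fin.zero_eta, Fin.mk_one, Fin.reduceFinMk, t0, d0, t10, t20, t30, t21, t31, t32,
      d10, d20, d30, d21, d31, d32] at h1 h2 h3 h4 h5 h6 ⊢
    linear_combination t 2 3 * h1 - t 1 3 * h2 + t 1 2 * h3 + t 0 3 * h4 - t 0 2 * h5
      + t 0 1 * h6

theorem det_eq_pfaffian_sq {t : Matrix (Fin 4) (Fin 4) ℝ} (ht : ∀ μ ν, t μ ν = -t ν μ) :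
    t.det = (t 0 1 * t 2 3 - t 0 2 * t 1 3 + t 0 3 * t 1 2) ^ 2 := by
  have t0 : ∀ μ, t μ μ = 0 := fun μ => by linarith [ht μ μ]
  have t10 := ht 1 0
  have t20 := ht 2 0
  have t30 := ht 3 0
  have t21 := ht 2 1
  have t31 := ht 3 1
  have t32 := ht 3 2
  rw [det_succ_row_zero]
  simp only [Fin.sum_univ_four, det_fin_three, submatrix_apply]
  simp [Fin.succAbove, t0, t10, t20, t30, t21, t31, t32]
  ring

/-- The symplectic volume form is preserved by Hamiltonian flows: `∂_μ (ρ θ^{μν}) = 0`. -/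
theorem liouville (hU : IsOpen U) (hθ : IsSymplecticPoisson U θ) {ρ : Pt → ℝ}
    (hρs : ContDiffOn ℝ ∞ ρ U) (hρ : ∀ z ∈ U, ρ z ^ 2 * (θ z).det = 1) (hy : y ∈ U) (ν : Fin 4) :
    ∑ μ, pd μ (fun z => ρ z * θ z μ ν) y = 0 := by
  have hd : ∀ μ ν, DifferentiableAt ℝ (fun z => θ z μ ν) y :=
    fun μ ν => differentiableAt_of_contDiffOn hU (hθ.smooth μ ν) hy
  have hρd := differentiableAt_of_contDiffOn hU hρs hy
  set p : Pt → ℝ := fun z => θ z 0 1 * θ z 2 3 - θ z 0 2 * θ z 1 3 + θ z 0 3 * θ z 1 2 with hp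
  have hm : ∀ α β γ δ, DifferentiableAt ℝ (fun z => θ z α β * θ z γ δ) y :=
    fun α β γ δ => (hd α β).fun_mul (hd γ δ)
  have hpd : DifferentiableAt ℝ p y := ((hm _ _ _ _).fun_sub (hm _ _ _ _)).fun_add (hm _ _ _ _)
  have hpp : ∀ μ, pd μ p y = pd μ (fun z => θ z 0 1) y * θ y 2 3
      + θ y 0 1 * pd μ (fun z => θ z 2 3) y
      - (pd μ (fun z => θ z 0 2) y * θ y 1 3 + θ y 0 2 * pd μ (fun z => θ z 1 3) y)
      + (pd μ (fun z => θ z 0 3) y * θ y 1 2 + θ y 0 3 * pd μ (fun z => θ z 1 2) y) := by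
    intro μ
    rw [hp, pd_add ((hm _ _ _ _).fun_sub (hm _ _ _ _)) (hm _ _ _ _), pd_sub (hm _ _ _ _)
      (hm _ _ _ _), pd_mul (hd _ _) (hd _ _), pd_mul (hd _ _) (hd _ _), pd_mul (hd _ _) (hd _ _)]
  have hsq : ∀ z ∈ U, (ρ z * p z) * (ρ z * p z) = 1 := by
    intro z hz
    rw [← hρ z hz, det_eq_pfaffian_sq (hθ.antisymm z hz)]
    ring
  have hne : ρ y * p y ≠ 0 := left_ne_zero_of_mul_eq_one (hsq y hy)
  -- `ρ p = ±1` is locally constant.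
  have hgrad : ∀ μ, pd μ ρ y * p y + ρ y * pd μ p y = 0 := by
    intro μ
    have h1 := pd_congr hU hy hsq μ
    rw [pd_const, pd_mul (hρd.fun_mul hpd) (hρd.fun_mul hpd), pd_mul hρd hpd] at h1
    have h2 : (pd μ ρ y * p y + ρ y * pd μ p y) * (2 * (ρ y * p y)) = 0 := by linarith
    exact (mul_eq_zero.1 h2).resolve_right (mul_ne_zero two_ne_zero hne)
  have hP := pfaffian_mul_divergence (t := θ y) (d := fun l μ ν => pd l (fun z => θ z μ ν) y)
    (hθ.antisymm y hy)
    (fun l μ ν => by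
      rw [pd_congr hU hy (fun z hz => hθ.antisymm z hz μ ν), pd_neg])
    (hθ.jacobi y hy) ν
  simp only [← hpp] at hP
  have hz : p y * ∑ μ, pd μ (fun z => ρ z * θ z μ ν) y = 0 := by
    have h3 : ∀ μ, pd μ (fun z => ρ z * θ z μ ν) y
        = pd μ ρ y * θ y μ ν + ρ y * pd μ (fun z => θ z μ ν) y := fun μ => pd_mul hρd (hd μ ν) μ
    have h4 : p y * ∑ μ, ρ y * pd μ (fun z => θ z μ ν) y
        = ρ y * ∑ μ, θ y μ ν * pd μ p y := by
      rw [← hP, ← Finset.mul_sum]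
      ring
    simp only [h3, Finset.sum_add_distrib, mul_add]
    rw [h4, Finset.mul_sum, Finset.mul_sum, ← Finset.sum_add_distrib]
    exact Finset.sum_eq_zero fun μ _ => by linear_combination θ y μ ν * hgrad μ
  exact (mul_eq_zero.1 hz).resolve_left (right_ne_zero_of_mul hne)

/-- `ρ {u, v}` is a divergence. -/
theorem rho_mul_pb (hU : IsOpen U) (hθ : IsSymplecticPoisson U θ) {ρ u v : Pt → ℝ}
    (hρs : ContDiffOn ℝ ∞ ρ U) (hρ : ∀ z ∈ U, ρ z ^ 2 * (θ z).det = 1) (hy : y ∈ U)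
    (hu : ContDiffOn ℝ ∞ u U) (hv : ContDiffOn ℝ ∞ v U) :
    ρ y * pb θ u v y
      = ∑ ν, pd ν (fun z => (∑ μ, ρ z * θ z μ ν * pd μ u z) * v z) y := by
  have hρθ : ∀ μ ν, ContDiffOn ℝ ∞ (fun z => ρ z * θ z μ ν) U := fun μ ν =>
    hρs.mul (hθ.smooth μ ν)
  have hterm : ∀ μ ν, ContDiffOn ℝ ∞ (fun z => ρ z * θ z μ ν * pd μ u z) U := fun μ ν =>
    (hρθ μ ν).mul (contDiffOn_pd hU hu μ)
  have hD : ∀ {f : Pt → ℝ}, ContDiffOn ℝ ∞ f U → DifferentiableAt ℝ f y :=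
    fun hf => differentiableAt_of_contDiffOn hU hf hy
  have h1 : ∀ ν, pd ν (fun z => (∑ μ, ρ z * θ z μ ν * pd μ u z) * v z) y
      = ∑ μ, pd ν (fun z => ρ z * θ z μ ν) y * pd μ u y * v y
        + ∑ μ, ρ y * θ y μ ν * pd ν (pd μ u) y * v y
        + ∑ μ, ρ y * θ y μ ν * pd μ u y * pd ν v y := by
    intro ν
    rw [pd_mul (hD (ContDiffOn.sum fun μ _ => hterm μ ν)) (hD hv),
      pd_sum fun μ _ => hD (hterm μ ν), Finset.sum_mul, Finset.sum_mul, ← Finset.sum_add_distrib,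
      ← Finset.sum_add_distrib, ← Finset.sum_add_distrib]
    refine Finset.sum_congr rfl fun μ _ => ?_
    rw [pd_mul (hD (hρθ μ ν)) (hD (contDiffOn_pd hU hu μ))]
    ring
  have h2 : ∑ ν, ∑ μ, pd ν (fun z => ρ z * θ z μ ν) y * pd μ u y * v y = 0 := by
    rw [Finset.sum_comm]
    refine Finset.sum_eq_zero fun μ _ => ?_
    have h3 : ∀ ν, pd ν (fun z => ρ z * θ z μ ν) y = -pd ν (fun z => ρ z * θ z ν μ) y := by
      intro ν
      rw [← pd_neg]
      exact pd_congr hU hy (fun z hz => by rw [hθ.antisymm z hz μ ν]; ring) ν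
    simp only [← Finset.sum_mul, h3, Finset.sum_neg_distrib, liouville hU hθ hρs hρ hy μ]
    simp
  -- The Hessian of `u` is symmetric and `θ` is antisymmetric.
  have h4 : ∑ ν, ∑ μ, ρ y * θ y μ ν * pd ν (pd μ u) y * v y = 0 := by
    have h5 : ∑ ν, ∑ μ, ρ y * θ y μ ν * pd ν (pd μ u) y * v y
        = -∑ ν, ∑ μ, ρ y * θ y μ ν * pd ν (pd μ u) y * v y := by
      conv_lhs => rw [Finset.sum_comm]
      simp only [← Finset.sum_neg_distrib]
      refine Finset.sum_congr rfl fun ν _ => Finset.sum_congr rfl fun μ _ => ?_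
      rw [hθ.antisymm y hy ν μ, pd_comm hU hu hy μ ν]
      ring
    linarith
  simp only [h1, Finset.sum_add_distrib, h2, h4, zero_add]
  rw [pb, Finset.sum_comm, Finset.mul_sum]
  refine Finset.sum_congr rfl fun ν _ => ?_
  rw [Finset.mul_sum]
  exact Finset.sum_congr rfl fun μ _ => by rw [smul_eq_mul]; ring

theorem pb_smooth (hU : IsOpen U) (hθ : IsSymplecticPoisson U θ) {u v : Pt → ℝ}
    (hu : ContDiffOn ℝ ∞ u U) (hv : ContDiffOn ℝ ∞ v U) : ContDiffOn ℝ ∞ (pb θ u v) U :=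
  ContDiffOn.sum fun μ _ => ContDiffOn.sum fun ν _ =>
    (hθ.smooth μ ν).smul ((contDiffOn_pd hU hu μ).mul (contDiffOn_pd hU hv ν))

theorem pb_eq_dotProduct (u v : Pt → ℝ) :
    pb θ u v y = (fun μ => pd μ u y) ⬝ᵥ (θ y *ᵥ fun ν => pd ν v y) := by
  simp only [pb, dotProduct, mulVec, Finset.mul_sum, smul_eq_mul]
  exact Finset.sum_congr rfl fun μ _ => Finset.sum_congr rfl fun ν _ => by ring

theorem pb_sum_left {ι : Type*} {s : Finset ι} {F : ι → Pt → ℝ} {c : ι → ℝ} {v : Pt → ℝ}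
    (hF : ∀ i ∈ s, DifferentiableAt ℝ (F i) y) :
    pb θ (fun z => ∑ i ∈ s, c i * F i z) v y = ∑ i ∈ s, c i * pb θ (F i) v y := by
  have : ∀ μ, pd μ (fun z => ∑ i ∈ s, c i * F i z) y = ∑ i ∈ s, c i * pd μ (F i) y := by
    intro μ
    rw [pd_sum fun i hi => (hF i hi).const_mul (c i)]
    exact Finset.sum_congr rfl fun i hi => pd_const_mul (hF i hi) _ μ
  simp only [pb, this, Finset.mul_sum, Finset.sum_mul, Finset.smul_sum]
  rw [Finset.sum_comm_cycle]
  refine Finset.sum_congr rfl fun i _ => ?_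
  refine Finset.sum_congr rfl fun μ _ => Finset.sum_congr rfl fun ν _ => ?_
  simp only [smul_eq_mul]
  ring

theorem pb_swap (hθ : IsSymplecticPoisson U θ) (hy : y ∈ U) (u v : Pt → ℝ) :
    pb θ u v y = -pb θ v u y := by
  rw [pb, pb, Finset.sum_comm, ← Finset.sum_neg_distrib]
  refine Finset.sum_congr rfl fun ν _ => ?_
  rw [← Finset.sum_neg_distrib]
  refine Finset.sum_congr rfl fun μ _ => ?_
  rw [hθ.antisymm y hy μ ν, smul_eq_mul, smul_eq_mul]
  ring

theorem pb_sum_right (hθ : IsSymplecticPoisson U θ) (hy : y ∈ U) {ι : Type*} {s : Finset ι}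
    {F : ι → Pt → ℝ} {c : ι → ℝ} {v : Pt → ℝ} (hF : ∀ i ∈ s, DifferentiableAt ℝ (F i) y) :
    pb θ v (fun z => ∑ i ∈ s, c i * F i z) y = ∑ i ∈ s, c i * pb θ v (F i) y := by
  rw [pb_swap hθ hy, pb_sum_left hF, ← Finset.sum_neg_distrib]
  exact Finset.sum_congr rfl fun i _ => by rw [pb_swap hθ hy v]; ring

end Poisson

/-! ### Contractions with the effective metric -/

section Effective

open Matrix

variable {D : ℕ} {η : Matrix (Fin D) (Fin D) ℝ} {x : Fin D → Pt → ℝ} {U : Set Pt} {y : Pt}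
  {θ : Pt → Matrix (Fin 4) (Fin 4) ℝ} {s ρ : Pt → ℝ}

theorem jac_mul_theta_mul_jac (a b : Fin D) :
    (jac x y * θ y * (jac x y)ᵀ) a b = pb θ (x a) (x b) y := by
  rw [pb_eq_dotProduct, dotProduct_mulVec, Matrix.mul_apply]
  rfl

/-- If `θ g θᵀ = s g⁻¹` then `{x^a, x^c} {x^b, x_c} = s g^{μν} ∂_μ x^a ∂_ν x^b`. -/
theorem sum_pb_mul_pb (heff : θ y * inducedMetric η x y * (θ y)ᵀ = s y • (inducedMetric η x y)⁻¹)
    (a b : Fin D) :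
    ∑ c, ∑ d, η c d * (pb θ (x a) (x c) y * pb θ (x b) (x d) y)
      = s y * (η⁻¹ a b - normalMatrix η x y a b) := by
  have h1 : (jac x y * θ y * (jac x y)ᵀ) * η * (jac x y * θ y * (jac x y)ᵀ)ᵀ
      = s y • (η⁻¹ - normalMatrix η x y) := by
    have h2 : (jac x y * θ y * (jac x y)ᵀ) * η * (jac x y * θ y * (jac x y)ᵀ)ᵀ
        = jac x y * (θ y * ((jac x y)ᵀ * η * jac x y) * (θ y)ᵀ) * (jac x y)ᵀ := by
      simp only [transpose_mul, transpose_transpose, Matrix.mul_assoc]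
    rw [h2, ← inducedMetric_eq, heff, normalMatrix, sub_sub_cancel, Matrix.mul_smul,
      Matrix.smul_mul]
  have h3 := congrFun (congrFun h1 a) b
  rw [Matrix.smul_apply, Matrix.sub_apply, smul_eq_mul] at h3
  rw [← h3]
  simp only [Matrix.mul_apply (N := (_ * _ * _)ᵀ), Matrix.mul_apply (N := η), transpose_apply,
    jac_mul_theta_mul_jac, Finset.sum_mul]
  rw [Finset.sum_comm]
  exact Finset.sum_congr rfl fun c _ => Finset.sum_congr rfl fun d _ => by ring

/-- The tangential projector has trace four. -/
theorem sum_tangent_eq_four (hη : η.IsSymm)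
    (hdet : (inducedMetric η x y).det ≠ 0) :
    ∑ a, ∑ b, η a b * (η⁻¹ a b - normalMatrix η x y a b) = 4 := by
  have h1 : ∑ a, ∑ b, η a b * (η⁻¹ a b - normalMatrix η x y a b)
      = (η * (η⁻¹ - normalMatrix η x y)ᵀ).trace := by
    simp only [trace, diag_apply, mul_apply, transpose_apply, Matrix.sub_apply]
  rw [h1, transpose_sub, normalMatrix_transpose hη, transpose_nonsing_inv, hη.eq, normalMatrix,
    sub_sub_cancel, trace_mul_comm, Matrix.mul_assoc, Matrix.mul_assoc, trace_mul_comm]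
  simp only [← Matrix.mul_assoc]
  rw [inverse_mul_metric hdet]
  simp

theorem sum_pb_sq (hη : η.IsSymm) (hdet : (inducedMetric η x y).det ≠ 0)
    (heff : θ y * inducedMetric η x y * (θ y)ᵀ = s y • (inducedMetric η x y)⁻¹) :
    ∑ a, ∑ b, ∑ c, ∑ d, η a c * η b d * pb θ (x a) (x b) y * pb θ (x c) (x d) y = 4 * s y := by
  have h1 : ∀ a b, ∑ c, ∑ d, η a c * η b d * pb θ (x a) (x b) y * pb θ (x c) (x d) y
      = ∑ c, η a c * ∑ d, η b d * (pb θ (x a) (x b) y * pb θ (x c) (x d) y) := by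
    intro a b
    simp only [Finset.mul_sum]
    exact Finset.sum_congr rfl fun c _ => Finset.sum_congr rfl fun d _ => by ring
  have h2 : ∀ a, ∑ b, ∑ c, η a c * ∑ d, η b d * (pb θ (x a) (x b) y * pb θ (x c) (x d) y)
      = ∑ c, η a c * (s y * (η⁻¹ a c - normalMatrix η x y a c)) := by
    intro a
    rw [Finset.sum_comm]
    refine Finset.sum_congr rfl fun c _ => ?_
    rw [← Finset.mul_sum, sum_pb_mul_pb heff]
  simp only [h1, h2]
  rw [← sum_tangent_eq_four hη hdet, Finset.sum_mul]
  refine Finset.sum_congr rfl fun a _ => ?_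
  rw [Finset.sum_mul]
  exact Finset.sum_congr rfl fun c _ => by ring

/-- A brane with a Poisson structure for which `θ g θᵀ = s g⁻¹`, that is, whose effective metric
is the induced metric `g`; here `s = e^σ` and `ρ` is the symplectic density. -/
structure IsSelfDualBrane (η : Matrix (Fin D) (Fin D) ℝ) (U : Set Pt) (x : Fin D → Pt → ℝ)
    (θ : Pt → Matrix (Fin 4) (Fin 4) ℝ) (s ρ : Pt → ℝ) : Prop where
  symm : η.IsSymm
  nondeg : η.det ≠ 0
  isOpen : IsOpen U
  embedding_smooth : ∀ a, ContDiffOn ℝ ∞ (x a) U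
  poisson : IsSymplecticPoisson U θ
  metric_det : ∀ z ∈ U, (inducedMetric η x z).det ≠ 0
  s_smooth : ContDiffOn ℝ ∞ s U
  rho_smooth : ContDiffOn ℝ ∞ ρ U
  rho_sq : ∀ z ∈ U, ρ z ^ 2 * (θ z).det = 1
  effective : ∀ z ∈ U, θ z * inducedMetric η x z * (θ z)ᵀ = s z • (inducedMetric η x z)⁻¹
  volume : ∀ z ∈ U, sqrtDet (inducedMetric η x) z = ρ z * s z

namespace IsSelfDualBrane

theorem effective_transpose (H : IsSelfDualBrane η U x θ s ρ) (hy : y ∈ U) :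
    (θ y)ᵀ * inducedMetric η x y * θ y = s y • (inducedMetric η x y)⁻¹ := by
  have h : (θ y)ᵀ = -θ y := by
    ext μ ν
    exact H.poisson.antisymm y hy ν μ
  rw [← H.effective y hy, h]
  simp

/-- `η_{ab} {x^a, f} {x^b, h} = s g^{μν} ∂_μ f ∂_ν h`. -/
theorem sum_pb_coord (H : IsSelfDualBrane η U x θ s ρ) (hy : y ∈ U) (f h : Pt → ℝ) :
    ∑ a, ∑ b, η a b * (pb θ (x a) f y * pb θ (x b) h y)
      = s y * ∑ μ, ∑ ν, (inducedMetric η x y)⁻¹ μ ν * (pd μ f y * pd ν h y) := by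
  set u : Fin 4 → ℝ := fun μ => pd μ f y
  set v : Fin 4 → ℝ := fun μ => pd μ h y
  have h1 : ∀ a (k : Pt → ℝ), pb θ (x a) k y = (jac x y *ᵥ (θ y *ᵥ fun μ => pd μ k y)) a :=
    fun a k => pb_eq_dotProduct _ _
  have h2 : ∑ a, ∑ b, η a b * (pb θ (x a) f y * pb θ (x b) h y)
      = (jac x y *ᵥ (θ y *ᵥ u)) ⬝ᵥ (η *ᵥ (jac x y *ᵥ (θ y *ᵥ v))) := by
    simp only [h1]
    rw [dotProduct]
    refine Finset.sum_congr rfl fun a _ => ?_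
    rw [mulVec.eq_1 η, dotProduct, Finset.mul_sum]
    exact Finset.sum_congr rfl fun b _ => by ring
  have h3 : (jac x y *ᵥ (θ y *ᵥ u)) ⬝ᵥ (η *ᵥ (jac x y *ᵥ (θ y *ᵥ v)))
      = u ⬝ᵥ (((θ y)ᵀ * ((jac x y)ᵀ * η * jac x y) * θ y) *ᵥ v) := by
    rw [mulVec_mulVec, ← vecMul_transpose, ← dotProduct_mulVec]
    simp only [mulVec_mulVec, transpose_mul, Matrix.mul_assoc]
  rw [h2, h3, ← inducedMetric_eq, H.effective_transpose hy, smul_mulVec, dotProduct_smul,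
    smul_eq_mul]
  congr 1
  simp only [dotProduct, mulVec, Finset.mul_sum]
  exact Finset.sum_congr rfl fun μ _ => Finset.sum_congr rfl fun ν _ => by ring

/-- The matrix Laplacian in the semi-classical limit: `η_{ab} {x^a, {x^b, f}} = s □_g f`. -/
theorem sum_pb_pb (H : IsSelfDualBrane η U x θ s ρ) (hy : y ∈ U) {f : Pt → ℝ}
    (hf : ContDiffOn ℝ ∞ f U) :
    ∑ a, ∑ b, η a b * pb θ (x a) (pb θ (x b) f) y
      = s y * laplaceBeltrami (inducedMetric η x) f y := by
  have hU := H.isOpen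
  have hx := H.embedding_smooth
  have hρ0 : ρ y ≠ 0 := fun h => by simpa [h] using H.rho_sq y hy
  have hq0 := (sqrtDet_pos (H.metric_det y hy)).ne'
  have hdiff : ∀ a b ν, DifferentiableAt ℝ
      (fun z => (∑ μ, ρ z * θ z μ ν * pd μ (x a) z) * pb θ (x b) f z) y := fun a b ν =>
    differentiableAt_of_contDiffOn hU ((ContDiffOn.sum fun μ _ =>
      (H.rho_smooth.mul (H.poisson.smooth μ ν)).mul (contDiffOn_pd hU (hx a) μ)).mul
        (pb_smooth hU H.poisson (hx b) hf)) hy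
  have key : ∀ ν, ∀ z ∈ U, ∑ a, ∑ b, η a b *
        ((∑ μ, ρ z * θ z μ ν * pd μ (x a) z) * pb θ (x b) f z)
      = ∑ l, sqrtDet (inducedMetric η x) z * (inducedMetric η x z)⁻¹ ν l * pd l f z := by
    intro ν z hz
    have h1 : ∀ b, pb θ (x b) f z = (jac x z *ᵥ (θ z *ᵥ fun μ => pd μ f z)) b :=
      fun b => pb_eq_dotProduct _ _
    have h2 : ∀ a, ∑ μ, ρ z * θ z μ ν * pd μ (x a) z = ρ z * ((θ z)ᵀ * (jac x z)ᵀ) ν a := by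
      intro a
      rw [mul_apply, Finset.mul_sum]
      exact Finset.sum_congr rfl fun μ _ => mul_assoc _ _ _
    have h3 : ∑ a, ∑ b, η a b *
          ((∑ μ, ρ z * θ z μ ν * pd μ (x a) z) * pb θ (x b) f z)
        = ρ z * ((((θ z)ᵀ * (jac x z)ᵀ) *ᵥ
          (η *ᵥ (jac x z *ᵥ (θ z *ᵥ fun μ => pd μ f z)))) ν) := by
      rw [mulVec, dotProduct, Finset.mul_sum]
      refine Finset.sum_congr rfl fun a _ => ?_
      rw [mulVec, dotProduct, Finset.mul_sum, Finset.mul_sum]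
      exact Finset.sum_congr rfl fun b _ => by rw [h1, h2]; ring
    have h4 : (θ z)ᵀ * (jac x z)ᵀ * η * jac x z * θ z = s z • (inducedMetric η x z)⁻¹ := by
      rw [← H.effective_transpose hz, inducedMetric_eq]
      simp only [Matrix.mul_assoc]
    rw [h3, mulVec_mulVec, mulVec_mulVec, mulVec_mulVec, h4, H.volume z hz, smul_mulVec,
      Pi.smul_apply, smul_eq_mul, mulVec, dotProduct, Finset.mul_sum, Finset.mul_sum]
    exact Finset.sum_congr rfl fun l _ => by ring
  have h1 : ρ y * ∑ a, ∑ b, η a b * pb θ (x a) (pb θ (x b) f) y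
      = sqrtDet (inducedMetric η x) y * laplaceBeltrami (inducedMetric η x) f y := by
    rw [laplaceBeltrami, mul_inv_cancel_left₀ hq0]
    simp only [Finset.mul_sum]
    have h2 : ∀ a b, ρ y * (η a b * pb θ (x a) (pb θ (x b) f) y)
        = ∑ ν, η a b * pd ν (fun z => (∑ μ, ρ z * θ z μ ν * pd μ (x a) z) * pb θ (x b) f z) y := by
      intro a b
      rw [← Finset.mul_sum, ← rho_mul_pb hU H.poisson H.rho_smooth H.rho_sq hy (hx a)
        (pb_smooth hU H.poisson (hx b) hf)]
      ring
    simp only [h2]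
    rw [Finset.sum_comm_cycle]
    refine Finset.sum_congr rfl fun ν _ => ?_
    rw [← pd_congr hU hy (key ν) ν]
    exact (pd_sum_sum_const_mul (fun a b => hdiff a b ν) ν).symm
  rw [H.volume y hy, mul_assoc] at h1
  exact mul_left_cancel₀ hρ0 h1

/-- The semi-classical limit of `[X^a, T^{bc}] [X_a, T_{bc}] + 2 T^{bc} □X_b □X_c` at a point,
as a combination of `|∂ e^σ|²` and of the scalar curvature. -/
theorem local_identity (H : IsSelfDualBrane η U x θ s ρ) (hy : y ∈ U) :
    -(s y * ∑ μ, ∑ ν, (inducedMetric η x y)⁻¹ μ ν *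
        (mpd μ (fun z => s z • normalMatrix η x z) y * η
          * mpd ν (fun z => s z • normalMatrix η x z) y * η).trace)
      + 2 * (s y * ((η *ᵥ fun a => s y * laplaceBeltrami (inducedMetric η x) (x a) y) ⬝ᵥ
        (normalMatrix η x y *ᵥ
          (η *ᵥ fun a => s y * laplaceBeltrami (inducedMetric η x) (x a) y))))
      = s y * (2 * s y ^ 2 * scalarCurvature (inducedMetric η x) y
        - ((D : ℝ) - 4) *
          ∑ μ, ∑ ν, (inducedMetric η x y)⁻¹ μ ν * (pd μ s y * pd ν s y)) := by
  have hv : (fun a => s y * laplaceBeltrami (inducedMetric η x) (x a) y)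
      = s y • fun a => laplaceBeltrami (inducedMetric η x) (x a) y := rfl
  rw [gradient_sq_smul_normalMatrix H.symm H.nondeg H.isOpen H.embedding_smooth hy H.metric_det
    H.s_smooth, scalarCurvature_eq H.symm H.isOpen H.embedding_smooth hy H.metric_det, hv]
  simp only [mulVec_smul, smul_dotProduct, dotProduct_smul, smul_eq_mul]
  rw [normalMatrix_laplaceBeltrami H.symm H.nondeg H.isOpen H.embedding_smooth hy H.metric_det _
    (fun a => rfl)]
  simp only [mul_sub, Finset.sum_sub_distrib]
  ring

end IsSelfDualBrane

end Effective

/-! ### Semi-classical limits of the matrix expressions -/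

section Limits

open Matrix

variable {D : ℕ} {η : Matrix (Fin D) (Fin D) ℝ} {x : Fin D → Pt → ℝ} {U : Set Pt} {y : Pt}
  {θ : Pt → Matrix (Fin 4) (Fin 4) ℝ} {s ρ : Pt → ℝ}

/-- The coordinate functions `x_a = η_{ab} x^b` with lowered index. -/
def lowerCoord (η : Matrix (Fin D) (Fin D) ℝ) (x : Fin D → Pt → ℝ) (a : Fin D) (z : Pt) : ℝ :=
  ∑ b, η a b * x b z

theorem pd_of_eq_const_mul_ofReal (hU : IsOpen U) (hy : y ∈ U) {F : Pt → ℂ} {f : Pt → ℝ} {c : ℂ}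
    (hf : DifferentiableAt ℝ f y) (hF : ∀ z ∈ U, F z = c * (f z : ℂ)) (μ : Fin 4) :
    pd μ F y = c * ((pd μ f y : ℝ) : ℂ) := by
  have h1 : F =ᶠ[nhds y] fun z => c * (f z : ℂ) :=
    Filter.eventuallyEq_of_mem (hU.mem_nhds hy) hF
  have h2 : HasFDerivAt (fun z => (f z : ℂ)) (Complex.ofRealCLM.comp (fderiv ℝ f y)) y :=
    Complex.ofRealCLM.hasFDerivAt.comp y hf.hasFDerivAt
  rw [pd, h1.fderiv_eq, (h2.const_mul c).fderiv]
  simp [pd]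

open MatrixExpr in
/-- The limit of a commutator of expressions whose limits are `c f` and `d h`, with constants
`c, d` and real functions `f, h`. -/
theorem limit_comm (hU : IsOpen U) (hy : y ∈ U) {A B : MatrixExpr D} {c d : ℂ} {f h : Pt → ℝ}
    (hA : ∀ z ∈ U, A.limit θ x z = c * (f z : ℂ)) (hB : ∀ z ∈ U, B.limit θ x z = d * (h z : ℂ))
    (hf : ContDiffOn ℝ ∞ f U) (hh : ContDiffOn ℝ ∞ h U) :
    (comm A B).limit θ x y = Complex.I * c * d * ((pb θ f h y : ℝ) : ℂ) := by
  simp only [limit, pb,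
    pd_of_eq_const_mul_ofReal hU hy (differentiableAt_of_contDiffOn hU hf hy) hA,
    pd_of_eq_const_mul_ofReal hU hy (differentiableAt_of_contDiffOn hU hh hy) hB,
    Complex.ofReal_sum, Finset.mul_sum]
  refine Finset.sum_congr rfl fun μ _ => Finset.sum_congr rfl fun ν _ => ?_
  simp only [Complex.real_smul, smul_eq_mul, Complex.ofReal_mul]
  ring

namespace IsSelfDualBrane

theorem lowerCoord_smooth (H : IsSelfDualBrane η U x θ s ρ) (a : Fin D) :
    ContDiffOn ℝ ∞ (lowerCoord η x a) U :=
  ContDiffOn.sum fun b _ => contDiffOn_const.mul (H.embedding_smooth b)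

theorem coord_diff (H : IsSelfDualBrane η U x θ s ρ) (hy : y ∈ U) (a : Fin D) :
    DifferentiableAt ℝ (x a) y :=
  differentiableAt_of_contDiffOn H.isOpen (H.embedding_smooth a) hy

theorem pb_lowerCoord_left (H : IsSelfDualBrane η U x θ s ρ) (hy : y ∈ U) (a : Fin D)
    (f : Pt → ℝ) : pb θ (lowerCoord η x a) f y = ∑ b, η a b * pb θ (x b) f y :=
  pb_sum_left fun b _ => H.coord_diff hy b

theorem pb_lowerCoord_right (H : IsSelfDualBrane η U x θ s ρ) (hy : y ∈ U) (a : Fin D)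
    (f : Pt → ℝ) : pb θ f (lowerCoord η x a) y = ∑ b, η a b * pb θ f (x b) y :=
  pb_sum_right H.poisson hy fun b _ => H.coord_diff hy b

theorem limit_X (a : Fin D) (z : Pt) :
    (MatrixExpr.X a).limit θ x z = 1 * (x a z : ℂ) := by
  simp [MatrixExpr.limit]

theorem limit_lower (a : Fin D) (z : Pt) :
    (MatrixExpr.lower η MatrixExpr.X a).limit θ x z = 1 * (lowerCoord η x a z : ℂ) := by
  simp [MatrixExpr.limit, MatrixExpr.lower, lowerCoord]

theorem limit_commSq (H : IsSelfDualBrane η U x θ s ρ) (hy : y ∈ U) :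
    (MatrixExpr.commSq η).limit θ x y = -4 * (s y : ℂ) := by
  have h1 : ∀ c d, (MatrixExpr.comm (.X c) (.X d)).limit θ x y
      = Complex.I * ((pb θ (x c) (x d) y : ℝ) : ℂ) := fun c d => by
    rw [limit_comm H.isOpen hy (fun z _ => limit_X c z) (fun z _ => limit_X d z)
      (H.embedding_smooth c) (H.embedding_smooth d)]
    ring
  have h2 : ∀ c d, (MatrixExpr.comm (MatrixExpr.lower η .X c)
        (MatrixExpr.lower η .X d)).limit θ x y
      = Complex.I * ((∑ a, ∑ b, η c a * η d b * pb θ (x a) (x b) y : ℝ) : ℂ) := fun c d => by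
    rw [limit_comm H.isOpen hy (fun z _ => limit_lower c z) (fun z _ => limit_lower d z)
      (H.lowerCoord_smooth c) (H.lowerCoord_smooth d), H.pb_lowerCoord_left hy]
    simp only [H.pb_lowerCoord_right hy, Finset.mul_sum, mul_one, mul_assoc]
  have h3 : (MatrixExpr.commSq η).limit θ x y
      = ∑ c, ∑ d, (MatrixExpr.comm (.X c) (.X d)).limit θ x y
        * (MatrixExpr.comm (MatrixExpr.lower η .X c) (MatrixExpr.lower η .X d)).limit θ x y := rfl
  have h4 := sum_pb_sq (s := s) H.symm (H.metric_det y hy) (H.effective y hy)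
  have h5 : ∑ c, ∑ d, (MatrixExpr.comm (.X c) (.X d)).limit θ x y
        * (MatrixExpr.comm (MatrixExpr.lower η .X c) (MatrixExpr.lower η .X d)).limit θ x y
      = ((-∑ a, ∑ b, ∑ c, ∑ d,
        η a c * η b d * pb θ (x a) (x b) y * pb θ (x c) (x d) y : ℝ) : ℂ) := by
    simp only [h1, h2]
    rw [← Finset.sum_neg_distrib, Complex.ofReal_sum]
    refine Finset.sum_congr rfl fun a _ => ?_
    rw [← Finset.sum_neg_distrib, Complex.ofReal_sum]
    refine Finset.sum_congr rfl fun b _ => ?_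
    have : ∑ c, ∑ d, η a c * η b d * pb θ (x a) (x b) y * pb θ (x c) (x d) y
        = pb θ (x a) (x b) y * ∑ c, ∑ d, η a c * η b d * pb θ (x c) (x d) y := by
      simp only [Finset.mul_sum]
      exact Finset.sum_congr rfl fun c _ => Finset.sum_congr rfl fun d _ => by ring
    rw [this, Complex.ofReal_neg, Complex.ofReal_mul]
    linear_combination ((pb θ (x a) (x b) y : ℝ) : ℂ)
      * ((∑ c, ∑ d, η a c * η b d * pb θ (x c) (x d) y : ℝ) : ℂ) * Complex.I_mul_I
  rw [h3, h5, h4]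
  push_cast
  ring

theorem limit_T (H : IsSelfDualBrane η U x θ s ρ) (hy : y ∈ U) (a b : Fin D) :
    (MatrixExpr.T η a b).limit θ x y = 1 * ((s y * normalMatrix η x y a b : ℝ) : ℂ) := by
  have h1 : ∀ c d, (MatrixExpr.comm (.X c) (.X d)).limit θ x y
      = Complex.I * ((pb θ (x c) (x d) y : ℝ) : ℂ) := fun c d => by
    rw [limit_comm H.isOpen hy (fun z _ => limit_X c z) (fun z _ => limit_X d z)
      (H.embedding_smooth c) (H.embedding_smooth d)]
    ring
  have h2 : ∀ c d, (MatrixExpr.comm (.X c) (MatrixExpr.lower η .X d)).limit θ x y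
      = Complex.I * ((∑ b, η d b * pb θ (x c) (x b) y : ℝ) : ℂ) := fun c d => by
    rw [limit_comm H.isOpen hy (fun z _ => limit_X c z) (fun z _ => limit_lower d z)
      (H.embedding_smooth c) (H.lowerCoord_smooth d), H.pb_lowerCoord_right hy]
    ring
  have h3 : (MatrixExpr.T η a b).limit θ x y
      = ((1 / 2 : ℝ) : ℂ) * ∑ c, ((MatrixExpr.comm (.X a) (.X c)).limit θ x y
          * (MatrixExpr.comm (.X b) (MatrixExpr.lower η .X c)).limit θ x y
        + (MatrixExpr.comm (.X b) (MatrixExpr.lower η .X c)).limit θ x y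
          * (MatrixExpr.comm (.X a) (.X c)).limit θ x y)
        + ((-(1 / 4) * η⁻¹ a b : ℝ) : ℂ) * (MatrixExpr.commSq η).limit θ x y := rfl
  have h4 := sum_pb_mul_pb (H.effective y hy) a b
  have h5 : ∑ c, ((MatrixExpr.comm (.X a) (.X c)).limit θ x y
          * (MatrixExpr.comm (.X b) (MatrixExpr.lower η .X c)).limit θ x y
        + (MatrixExpr.comm (.X b) (MatrixExpr.lower η .X c)).limit θ x y
          * (MatrixExpr.comm (.X a) (.X c)).limit θ x y)
      = -2 * ((∑ c, ∑ d, η c d * (pb θ (x a) (x c) y * pb θ (x b) (x d) y) : ℝ) : ℂ) := by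
    rw [Complex.ofReal_sum, Finset.mul_sum]
    refine Finset.sum_congr rfl fun c _ => ?_
    have : ∑ d, η c d * (pb θ (x a) (x c) y * pb θ (x b) (x d) y)
        = pb θ (x a) (x c) y * ∑ d, η c d * pb θ (x b) (x d) y := by
      rw [Finset.mul_sum]
      exact Finset.sum_congr rfl fun d _ => by ring
    rw [h1, h2, this, Complex.ofReal_mul]
    linear_combination 2 * ((pb θ (x a) (x c) y : ℝ) : ℂ)
      * ((∑ d, η c d * pb θ (x b) (x d) y : ℝ) : ℂ) * Complex.I_mul_I
  rw [h3, h5, h4, H.limit_commSq hy]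
  push_cast
  ring

/-- Up to sign the limit of the matrix Laplacian `□` is `e^σ □_g`. -/
theorem limit_box (H : IsSelfDualBrane η U x θ s ρ) (hy : y ∈ U) {A : MatrixExpr D} {c : ℂ}
    {f : Pt → ℝ} (hA : ∀ z ∈ U, A.limit θ x z = c * (f z : ℂ)) (hf : ContDiffOn ℝ ∞ f U) :
    (MatrixExpr.box η A).limit θ x y
      = -c * ((s y * laplaceBeltrami (inducedMetric η x) f y : ℝ) : ℂ) := by
  have hpb : ∀ a, ContDiffOn ℝ ∞ (pb θ (x a) f) U := fun a =>
    pb_smooth H.isOpen H.poisson (H.embedding_smooth a) hf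
  have h1 : ∀ b, ∀ z ∈ U, (MatrixExpr.comm (MatrixExpr.lower η .X b) A).limit θ x z
      = (Complex.I * c) * ((∑ a, η b a * pb θ (x a) f z : ℝ) : ℂ) := by
    intro b z hz
    rw [limit_comm H.isOpen hz (fun z _ => limit_lower b z) hA (H.lowerCoord_smooth b) hf,
      H.pb_lowerCoord_left hz]
    ring
  have h2 : ∀ b, (MatrixExpr.comm (.X b)
        (MatrixExpr.comm (MatrixExpr.lower η .X b) A)).limit θ x y
      = -c * ((∑ a, η b a * pb θ (x b) (pb θ (x a) f) y : ℝ) : ℂ) := by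
    intro b
    rw [limit_comm H.isOpen hy (fun z _ => limit_X b z) (h1 b) (H.embedding_smooth b)
      (ContDiffOn.sum fun a _ => contDiffOn_const.mul (hpb a)),
      pb_sum_right H.poisson hy fun a _ => differentiableAt_of_contDiffOn H.isOpen (hpb a) hy]
    linear_combination c * ((∑ a, η b a * pb θ (x b) (pb θ (x a) f) y : ℝ) : ℂ)
      * Complex.I_mul_I
  have h3 : (MatrixExpr.box η A).limit θ x y = ∑ b, (MatrixExpr.comm (.X b)
        (MatrixExpr.comm (MatrixExpr.lower η .X b) A)).limit θ x y := rfl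
  rw [h3, ← H.sum_pb_pb hy hf, Complex.ofReal_sum, Finset.mul_sum]
  exact Finset.sum_congr rfl fun b _ => h2 b

theorem limit_S10tilde (H : IsSelfDualBrane η U x θ s ρ) (hy : y ∈ U) :
    (MatrixExpr.S10tilde η).limit θ x y
      = ((-16 * (s y * (s y * laplaceBeltrami (inducedMetric η x) s y)) : ℝ) : ℂ) := by
  have h : (MatrixExpr.S10tilde η).limit θ x y = (MatrixExpr.commSq η).limit θ x y
      * (MatrixExpr.box η (MatrixExpr.commSq η)).limit θ x y := rfl
  rw [h, H.limit_box hy (fun z hz => H.limit_commSq hz) H.s_smooth, H.limit_commSq hy]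
  push_cast
  ring

theorem laplaceBeltrami_lowerCoord (H : IsSelfDualBrane η U x θ s ρ) (hy : y ∈ U) (a : Fin D) :
    laplaceBeltrami (inducedMetric η x) (lowerCoord η x a) y
      = ∑ b, η a b * laplaceBeltrami (inducedMetric η x) (x b) y := by
  have hU := H.isOpen
  have hpd : ∀ z ∈ U, ∀ ν, pd ν (lowerCoord η x a) z = ∑ b, η a b * pd ν (x b) z := by
    intro z hz ν
    have : lowerCoord η x a = fun z => ∑ b, η a b * x b z := rfl
    rw [this, pd_sum (F := fun b z => η a b * x b z) fun b _ => (H.coord_diff hz b).const_mul _]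
    exact Finset.sum_congr rfl fun b _ => pd_const_mul (H.coord_diff hz b) _ ν
  have hV : ∀ μ b, ContDiffOn ℝ ∞ (fun z => ∑ ν, sqrtDet (inducedMetric η x) z *
      (inducedMetric η x z)⁻¹ μ ν * pd ν (x b) z) U := fun μ b => ContDiffOn.sum fun ν _ =>
    ((sqrtDet_smooth (metric_smooth hU H.embedding_smooth) H.metric_det).mul
      (inverse_smooth hU H.embedding_smooth H.metric_det μ ν)).mul
      (contDiffOn_pd hU (H.embedding_smooth b) ν)
  have h1 : ∀ μ, pd μ (fun z => ∑ ν, sqrtDet (inducedMetric η x) z *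
        (inducedMetric η x z)⁻¹ μ ν * pd ν (lowerCoord η x a) z) y
      = ∑ b, η a b * pd μ (fun z => ∑ ν, sqrtDet (inducedMetric η x) z *
        (inducedMetric η x z)⁻¹ μ ν * pd ν (x b) z) y := by
    intro μ
    rw [pd_congr (h := fun z => ∑ b, η a b * ∑ ν, sqrtDet (inducedMetric η x) z *
        (inducedMetric η x z)⁻¹ μ ν * pd ν (x b) z) hU hy (fun z hz => ?_) μ,
      pd_sum fun b _ => (differentiableAt_of_contDiffOn hU (hV μ b) hy).const_mul _]
    · exact Finset.sum_congr rfl fun b _ =>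
        pd_const_mul (differentiableAt_of_contDiffOn hU (hV μ b) hy) _ μ
    · simp only [hpd z hz, Finset.mul_sum]
      rw [Finset.sum_comm]
      exact Finset.sum_congr rfl fun b _ => Finset.sum_congr rfl fun ν _ => by ring
  simp only [laplaceBeltrami, h1, Finset.mul_sum]
  rw [Finset.sum_comm]
  exact Finset.sum_congr rfl fun b _ => Finset.sum_congr rfl fun ν _ => by ring

theorem limit_boxXlow (H : IsSelfDualBrane η U x θ s ρ) (hy : y ∈ U) (a : Fin D) :
    (MatrixExpr.boxXlow η a).limit θ x y = -1 *
      (((η *ᵥ fun b => s y * laplaceBeltrami (inducedMetric η x) (x b) y) a : ℝ) : ℂ) := by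
  rw [MatrixExpr.boxXlow, H.limit_box hy (fun z _ => limit_lower a z) (H.lowerCoord_smooth a),
    H.laplaceBeltrami_lowerCoord hy, mulVec, dotProduct, Finset.mul_sum]
  congr 2
  exact Finset.sum_congr rfl fun b _ => by ring

/-- The limit of the first expression of order ten, at a point. -/
theorem limit_S10 (H : IsSelfDualBrane η U x θ s ρ) (hy : y ∈ U) :
    (MatrixExpr.S10 η).limit θ x y
      = ((s y * (2 * s y ^ 2 * scalarCurvature (inducedMetric η x) y
        - ((D : ℝ) - 4) *
          ∑ μ, ∑ ν, (inducedMetric η x y)⁻¹ μ ν * (pd μ s y * pd ν s y)) : ℝ) : ℂ) := by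
  have hU := H.isOpen
  set t : Fin D → Fin D → Pt → ℝ := fun b c z => s z * normalMatrix η x z b c with ht
  set M : Fin 4 → Matrix (Fin D) (Fin D) ℝ :=
    fun μ => mpd μ (fun z => s z • normalMatrix η x z) y with hM
  have htM : ∀ μ b c, pd μ (t b c) y = M μ b c := fun μ b c => rfl
  have hMt : ∀ μ, (M μ)ᵀ = M μ := fun μ => by
    ext b c
    refine pd_congr hU hy (fun z _ => ?_) μ
    change s z * normalMatrix η x z c b = s z * normalMatrix η x z b c
    conv_lhs => rw [← normalMatrix_transpose H.symm z]
    rfl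
  have hts : ∀ b c, ContDiffOn ℝ ∞ (t b c) U := fun b c =>
    H.s_smooth.mul (normalMatrix_smooth hU H.embedding_smooth H.metric_det b c)
  have hTlow : ∀ b c, ∀ z ∈ U, (MatrixExpr.Tlow η b c).limit θ x z
      = 1 * ((∑ d, ∑ e, η b d * η c e * t d e z : ℝ) : ℂ) := by
    intro b c z hz
    have : (MatrixExpr.Tlow η b c).limit θ x z = ∑ d, ∑ e, ((η b d * η c e : ℝ) : ℂ)
      * (MatrixExpr.T η d e).limit θ x z := rfl
    simp only [this, H.limit_T hz, one_mul, Complex.ofReal_sum, Complex.ofReal_mul, ht]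
  have hTlows : ∀ b c, ContDiffOn ℝ ∞ (fun z => ∑ d, ∑ e, η b d * η c e * t d e z) U :=
    fun b c => ContDiffOn.sum fun d _ => ContDiffOn.sum fun e _ => contDiffOn_const.mul (hts d e)
  have h1 : ∀ a b c, (MatrixExpr.comm (.X a) (MatrixExpr.T η b c)).limit θ x y
        * (MatrixExpr.comm (MatrixExpr.lower η .X a) (MatrixExpr.Tlow η b c)).limit θ x y
      = ((-∑ a', η a a' * (pb θ (x a) (t b c) y
        * pb θ (x a') (fun z => ∑ d, ∑ e, η b d * η c e * t d e z) y) : ℝ) : ℂ) := by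
    intro a b c
    rw [limit_comm hU hy (fun z _ => limit_X a z) (fun z hz => H.limit_T hz b c)
        (H.embedding_smooth a) (hts b c),
      limit_comm hU hy (fun z _ => limit_lower a z) (hTlow b c) (H.lowerCoord_smooth a)
        (hTlows b c), H.pb_lowerCoord_left hy]
    have : ∑ a', η a a' * (pb θ (x a) (t b c) y
          * pb θ (x a') (fun z => ∑ d, ∑ e, η b d * η c e * t d e z) y)
        = pb θ (x a) (t b c) y * ∑ a', η a a'
          * pb θ (x a') (fun z => ∑ d, ∑ e, η b d * η c e * t d e z) y := by
      rw [Finset.mul_sum]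
      exact Finset.sum_congr rfl fun d _ => by ring
    rw [this, Complex.ofReal_neg, Complex.ofReal_mul]
    linear_combination ((pb θ (x a) (t b c) y : ℝ) : ℂ) * ((∑ a', η a a'
          * pb θ (x a') (fun z => ∑ d, ∑ e, η b d * η c e * t d e z) y : ℝ) : ℂ)
          * Complex.I_mul_I
  have htr : ∀ μ ν, ∑ b, ∑ c, M μ b c * ∑ d, ∑ e, η b d * η c e * M ν d e
      = (M μ * η * M ν * η).trace := by
    intro μ ν
    have e1 : M μ * η * M ν * η = M μ * (η * M ν * η)ᵀ := by
      simp only [transpose_mul, hMt, H.symm.eq, Matrix.mul_assoc]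
    rw [e1]
    simp only [trace, diag_apply, mul_apply (M := M μ), transpose_apply]
    refine Finset.sum_congr rfl fun b _ => Finset.sum_congr rfl fun c _ => ?_
    congr 1
    have hs : ∀ e, η c e = η e c := fun e => H.symm.apply e c
    simp only [mul_apply, Finset.sum_mul, hs]
    rw [Finset.sum_comm]
    exact Finset.sum_congr rfl fun d _ => Finset.sum_congr rfl fun e _ => by ring
  have h2 : ∑ a, ∑ b, ∑ c, -∑ a', η a a' * (pb θ (x a) (t b c) y
        * pb θ (x a') (fun z => ∑ d, ∑ e, η b d * η c e * t d e z) y)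
      = -(s y * ∑ μ, ∑ ν, (inducedMetric η x y)⁻¹ μ ν * (M μ * η * M ν * η).trace) := by
    have e2 : ∀ b c ν, pd ν (fun z => ∑ d, ∑ e, η b d * η c e * t d e z) y
        = ∑ d, ∑ e, η b d * η c e * M ν d e := by
      intro b c ν
      exact pd_sum_sum_const_mul (fun d e => differentiableAt_of_contDiffOn hU (hts d e) hy) ν
    have e3 : ∀ Q : Fin 4 → Fin D → Fin D → ℝ,
        ∑ b, ∑ c, s y * ∑ μ, ∑ ν, (inducedMetric η x y)⁻¹ μ ν * (M μ b c * Q ν b c)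
          = s y * ∑ μ, ∑ ν, (inducedMetric η x y)⁻¹ μ ν * ∑ b, ∑ c, M μ b c * Q ν b c := by
      intro Q
      simp only [Finset.mul_sum]
      rw [Finset.sum_comm_cycle]
      exact Finset.sum_congr rfl fun μ _ => Finset.sum_comm_cycle
    rw [Finset.sum_comm_cycle, Finset.sum_comm_cycle]
    simp only [Finset.sum_neg_distrib, H.sum_pb_coord hy, e2, htM, ← htr]
    rw [e3 fun ν b c => ∑ d, ∑ e, η b d * η c e * M ν d e]
  have h3 : (MatrixExpr.S10 η).limit θ x y
      = ∑ a, ∑ b, ∑ c, (MatrixExpr.comm (.X a) (MatrixExpr.T η b c)).limit θ x y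
        * (MatrixExpr.comm (MatrixExpr.lower η .X a) (MatrixExpr.Tlow η b c)).limit θ x y
        + ((2 : ℝ) : ℂ) * ∑ b, ∑ c, (MatrixExpr.T η b c).limit θ x y
          * (MatrixExpr.boxXlow η b).limit θ x y * (MatrixExpr.boxXlow η c).limit θ x y := rfl
  rw [h3, ← H.local_identity hy, Complex.ofReal_add, ← h2]
  simp only [h1, H.limit_T hy, H.limit_boxXlow hy]
  set w := η *ᵥ fun b => s y * laplaceBeltrami (inducedMetric η x) (x b) y
  congr 1
  · simp only [Complex.ofReal_sum]
  · rw [Complex.ofReal_mul]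
    congr 1
    simp only [dotProduct, mulVec, Finset.mul_sum, Complex.ofReal_sum]
    refine Finset.sum_congr rfl fun b _ => Finset.sum_congr rfl fun c _ => ?_
    push_cast
    ring

end IsSelfDualBrane

end Limits

/-! ### Integration by parts against cut-offs -/

section Integration

open MeasureTheory

variable {U : Set Pt}

theorem continuous_mul_of_tsupport_subset (hU : IsOpen U) {χ f : Pt → ℝ} (hχ : Continuous χ)
    (hsub : tsupport χ ⊆ U) (hf : ContinuousOn f U) : Continuous fun z => χ z * f z :=
  (hχ.continuousOn.mul hf).continuous_of_tsupport_subset hU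
    ((tsupport_mul_subset_left (f := χ) (g := f)).trans hsub)

theorem integrable_mul_of_tsupport_subset (hU : IsOpen U) {χ f : Pt → ℝ} (hχ : Continuous χ)
    (hc : HasCompactSupport χ) (hsub : tsupport χ ⊆ U) (hf : ContinuousOn f U) :
    Integrable fun z => χ z * f z :=
  (continuous_mul_of_tsupport_subset hU hχ hsub hf).integrable_of_hasCompactSupport hc.mul_right

theorem tsupport_pd_subset (χ : Pt → ℝ) (μ : Fin 4) : tsupport (pd μ χ) ⊆ tsupport χ :=
  tsupport_fderiv_apply_subset ℝ _

theorem setIntegral_mul_divergence (hU : IsOpen U) {w : Fin 4 → Pt → ℝ}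
    (hw : ∀ μ, ContDiffOn ℝ ∞ (w μ) U) {χ : Pt → ℝ} (hχ : ContDiff ℝ ∞ χ)
    (hc : HasCompactSupport χ) (hsub : tsupport χ ⊆ U) :
    ∫ y in U, χ y * ∑ μ, pd μ (w μ) y = -∫ y in U, ∑ μ, w μ y * pd μ χ y := by
  have hpc : ∀ μ, Continuous (pd μ χ) := fun μ =>
    (hχ.continuous_fderiv (by simp)).clm_apply continuous_const
  have hps : ∀ μ, tsupport (pd μ χ) ⊆ U := fun μ => (tsupport_pd_subset χ μ).trans hsub
  have hpk : ∀ μ, HasCompactSupport (pd μ χ) := fun μ =>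
    hc.of_isClosed_subset (isClosed_tsupport _) (tsupport_pd_subset χ μ)
  have i1 : ∀ μ, Integrable fun z => χ z * pd μ (w μ) z := fun μ =>
    integrable_mul_of_tsupport_subset hU hχ.continuous hc hsub
      (contDiffOn_pd hU (hw μ) μ).continuousOn
  have i2 : ∀ μ, Integrable fun z => pd μ χ z * w μ z := fun μ =>
    integrable_mul_of_tsupport_subset hU (hpc μ) (hpk μ) (hps μ) (hw μ).continuousOn
  have i3 : ∀ μ, Integrable fun z => χ z * w μ z := fun μ =>
    integrable_mul_of_tsupport_subset hU hχ.continuous hc hsub (hw μ).continuousOn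
  have hz : ∀ {ψ : Pt → ℝ}, tsupport ψ ⊆ U → ∀ z ∉ U, ψ z = 0 := fun h z hz =>
    image_eq_zero_of_notMem_tsupport fun h' => hz (h h')
  have key : ∀ μ, ∫ y in U, χ y * pd μ (w μ) y = -∫ y in U, pd μ χ y * w μ y := by
    intro μ
    rw [setIntegral_eq_integral_of_forall_compl_eq_zero fun z hzU => by
        rw [hz hsub z hzU, zero_mul],
      setIntegral_eq_integral_of_forall_compl_eq_zero fun z hzU => by
        rw [hz (hps μ) z hzU, zero_mul]]
    exact integral_bilinear_hasLineDerivAt_right_eq_neg_left_of_integrable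
      (B := ContinuousLinearMap.mul ℝ ℝ) (v := Pi.single μ 1) (i2 μ) (i1 μ) (i3 μ)
      (fun z _ => ((hχ.differentiable (by simp)).differentiableAt.hasFDerivAt).hasLineDerivAt _)
      (fun z hz => (differentiableAt_of_contDiffOn hU (hw μ)
        (hsub hz)).hasFDerivAt.hasLineDerivAt _)
  simp only [Finset.mul_sum]
  rw [integral_finsetSum _ fun μ _ => (i1 μ).integrableOn]
  simp only [mul_comm (w _ _)]
  rw [integral_finsetSum _ fun μ _ => (i2 μ).integrableOn, ← Finset.sum_neg_distrib]
  exact Finset.sum_congr rfl fun μ _ => key μ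

/-- An integrable divergence integrates to zero if the vector density has no boundary flux. -/
theorem setIntegral_divergence_eq_zero (hU : IsOpen U) {w : Fin 4 → Pt → ℝ}
    (hw : ∀ μ, ContDiffOn ℝ ∞ (w μ) U) (hflux : NoBoundaryFlux U w)
    (hint : IntegrableOn (fun y => ∑ μ, pd μ (w μ) y) U) :
    ∫ y in U, ∑ μ, pd μ (w μ) y = 0 := by
  obtain ⟨χ, hχ, hlim, hfl⟩ := hflux
  have h1 : Filter.Tendsto (fun k => ∫ y in U, χ k y * ∑ μ, pd μ (w μ) y) Filter.atTop
      (nhds (∫ y in U, ∑ μ, pd μ (w μ) y)) := by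
    refine tendsto_integral_of_dominated_convergence (fun y => ‖∑ μ, pd μ (w μ) y‖) (fun k => ?_)
      hint.norm (fun k => ?_) ?_
    · exact (hχ k).1.continuous.aestronglyMeasurable.mul hint.aestronglyMeasurable
    · refine Filter.Eventually.of_forall fun y => ?_
      obtain ⟨h0, h1⟩ := (hχ k).2.2.2 y
      rw [norm_mul, Real.norm_of_nonneg h0]
      exact mul_le_of_le_one_left (norm_nonneg _) h1
    · refine (ae_restrict_iff' hU.measurableSet).2 (Filter.Eventually.of_forall fun y hy => ?_)
      simpa using (hlim y hy).mul_const (∑ μ, pd μ (w μ) y)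
  have h2 : ∀ k, ∫ y in U, χ k y * ∑ μ, pd μ (w μ) y = -∫ y in U, ∑ μ, w μ y * pd μ (χ k) y :=
    fun k => setIntegral_mul_divergence hU hw (hχ k).1 (hχ k).2.1 (hχ k).2.2.1
  simp only [h2] at h1
  have h3 := hfl.neg
  rw [neg_zero] at h3
  exact tendsto_nhds_unique h1 h3

end Integration

/-! ### The action densities -/

section Densities

open Matrix

variable {D : ℕ} {η : Matrix (Fin D) (Fin D) ℝ} {x : Fin D → Pt → ℝ} {U : Set Pt} {y : Pt}
  {θ : Pt → Matrix (Fin 4) (Fin 4) ℝ} {σ : Pt → ℝ}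

/-- The metric relations in matrix form. The determinant of `θ⁻¹` is positive because the density
relation would otherwise read `e^{-σ} = 0`. -/
theorem isSelfDualBrane_of_effectiveMetric (hη : η.IsSymm) (hη' : η.det ≠ 0) (hU : IsOpen U)
    (hx : ∀ a, ContDiffOn ℝ ∞ (x a) U) (hθ : IsSymplecticPoisson U θ)
    (hdet : ∀ y ∈ U, (inducedMetric η x y).det ≠ 0)
    (hσ : ∀ y ∈ U, Real.exp (-σ y) =
      rho θ y / sqrtDet (effectiveMetric θ (inducedMetric η x) σ) y)
    (hG : ∀ y ∈ U, effectiveMetric θ (inducedMetric η x) σ y = inducedMetric η x y) :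
    IsSelfDualBrane η U x θ (fun z => Real.exp (σ z)) (rho θ) := by
  have heff : ∀ z ∈ U, θ z * inducedMetric η x z * (θ z)ᵀ
      = Real.exp (σ z) • (inducedMetric η x z)⁻¹ := by
    intro z hz
    have h1 : effectiveInv θ (inducedMetric η x) σ z
        = Real.exp (-σ z) • (θ z * inducedMetric η x z * (θ z)ᵀ) := by
      ext μ ν
      simp only [effectiveInv, of_apply, Matrix.smul_apply, smul_eq_mul, mul_apply,
        transpose_apply, Finset.sum_mul]
      rw [Finset.sum_comm]
      congr 1
      exact Finset.sum_congr rfl fun κ _ => Finset.sum_congr rfl fun l _ => by ring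
    have h2 : effectiveInv θ (inducedMetric η x) σ z = (inducedMetric η x z)⁻¹ := by
      have h3 := hG z hz
      rw [effectiveMetric] at h3
      have h4 : IsUnit (effectiveInv θ (inducedMetric η x) σ z).det := by
        by_contra hn
        rw [nonsing_inv_apply_not_isUnit _ hn] at h3
        apply hdet z hz
        rw [← h3]
        simp
      rw [← h3, nonsing_inv_nonsing_inv _ h4]
    rw [← h2, h1, smul_smul, ← Real.exp_add, add_neg_cancel, Real.exp_zero, one_smul]
  have hvol : ∀ z ∈ U, sqrtDet (inducedMetric η x) z = rho θ z * Real.exp (σ z) := by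
    intro z hz
    have h1 := hσ z hz
    have h2 : sqrtDet (effectiveMetric θ (inducedMetric η x) σ) z
        = sqrtDet (inducedMetric η x) z := by
      rw [sqrtDet, sqrtDet, hG z hz]
    have h3 := (sqrtDet_pos (hdet z hz)).ne'
    rw [h2, eq_div_iff h3, Real.exp_neg] at h1
    rw [← h1]
    field_simp
  have hs : ContDiffOn ℝ ∞ (fun z => Real.exp (σ z)) U := by
    have h1 : ContDiffOn ℝ ∞ (fun z => 1 / 4 * ∑ a, ∑ b, ∑ c, ∑ d,
        η a c * η b d * pb θ (x a) (x b) z * pb θ (x c) (x d) z) U :=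
      contDiffOn_const.mul (ContDiffOn.sum fun a _ => ContDiffOn.sum fun b _ =>
        ContDiffOn.sum fun c _ => ContDiffOn.sum fun d _ =>
          (contDiffOn_const.mul (pb_smooth hU hθ (hx a) (hx b))).mul
            (pb_smooth hU hθ (hx c) (hx d)))
    refine h1.congr fun z hz => ?_
    rw [sum_pb_sq (s := fun z => Real.exp (σ z)) hη (hdet z hz) (heff z hz)]
    ring
  refine ⟨hη, hη', hU, hx, hθ, hdet, hs, ?_, fun z hz => ?_, heff, hvol⟩
  · refine ((sqrtDet_smooth (metric_smooth hU hx) hdet).div hs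
      fun z _ => (Real.exp_pos _).ne').congr fun z hz => ?_
    rw [Pi.div_apply, hvol z hz, mul_div_cancel_right₀ _ (Real.exp_pos _).ne']
  · have h1 : 0 < rho θ z := by
      have h2 := sqrtDet_pos (hdet z hz)
      rw [hvol z hz] at h2
      exact (pos_iff_pos_of_mul_pos h2).2 (Real.exp_pos _)
    rw [rho, Real.sq_sqrt (Real.sqrt_pos.1 h1).le, det_nonsing_inv, Ring.inverse_eq_inv',
      inv_mul_cancel₀ (hθ.nondeg z hz)]

theorem traceDensity_S10tilde
    (H : IsSelfDualBrane η U x θ (fun z => Real.exp (σ z)) (rho θ)) (hy : y ∈ U) :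
    traceDensity θ x (MatrixExpr.S10tilde η) y
      = ((-16 * dilatonDensity (inducedMetric η x) σ y : ℝ) : ℂ) := by
  rw [traceDensity, H.limit_S10tilde hy, dilatonDensity, H.volume y hy, ← Complex.ofReal_mul]
  congr 1
  ring

theorem dilatonCurrent_smooth
    (H : IsSelfDualBrane η U x θ (fun z => Real.exp (σ z)) (rho θ)) (μ : Fin 4) :
    ContDiffOn ℝ ∞ (dilatonCurrent (inducedMetric η x) σ μ) U :=
  ((sqrtDet_smooth (metric_smooth H.isOpen H.embedding_smooth) H.metric_det).mul H.s_smooth).mul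
    (ContDiffOn.sum fun ν _ =>
      (inverse_smooth H.isOpen H.embedding_smooth H.metric_det μ ν).mul
        (contDiffOn_pd H.isOpen H.s_smooth ν))

theorem divergence_dilatonCurrent
    (H : IsSelfDualBrane η U x θ (fun z => Real.exp (σ z)) (rho θ)) (hy : y ∈ U) :
    ∑ μ, pd μ (dilatonCurrent (inducedMetric η x) σ μ) y
      = sqrtDet (inducedMetric η x) y *
        (Real.exp (σ y) * laplaceBeltrami (inducedMetric η x) (fun z => Real.exp (σ z)) y
          + ∑ μ, ∑ ν, (inducedMetric η x y)⁻¹ μ ν * (pd μ (fun z => Real.exp (σ z)) y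
            * pd ν (fun z => Real.exp (σ z)) y)) := by
  have hU := H.isOpen
  have hV : ∀ μ, ContDiffOn ℝ ∞ (fun z => ∑ ν, sqrtDet (inducedMetric η x) z *
      (inducedMetric η x z)⁻¹ μ ν * pd ν (fun z => Real.exp (σ z)) z) U := fun μ =>
    ContDiffOn.sum fun ν _ =>
      ((sqrtDet_smooth (metric_smooth hU H.embedding_smooth) H.metric_det).mul
        (inverse_smooth hU H.embedding_smooth H.metric_det μ ν)).mul
          (contDiffOn_pd hU H.s_smooth ν)
  have hw : ∀ μ, dilatonCurrent (inducedMetric η x) σ μ = fun z => Real.exp (σ z) *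
      ∑ ν, sqrtDet (inducedMetric η x) z *
        (inducedMetric η x z)⁻¹ μ ν * pd ν (fun z => Real.exp (σ z)) z := by
    intro μ
    funext z
    rw [dilatonCurrent, Finset.mul_sum, Finset.mul_sum]
    exact Finset.sum_congr rfl fun ν _ => by ring
  have hq := (sqrtDet_pos (H.metric_det y hy)).ne'
  simp only [hw]
  simp only [pd_mul (differentiableAt_of_contDiffOn hU H.s_smooth hy)
    (differentiableAt_of_contDiffOn hU (hV _) hy), Finset.sum_add_distrib]
  rw [mul_add, add_comm, laplaceBeltrami, ← Finset.mul_sum]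
  congr 1
  · field_simp
  · simp only [Finset.mul_sum]
    exact Finset.sum_congr rfl fun μ _ => Finset.sum_congr rfl fun ν _ => by ring

/-- The two densities differ by a multiple of the divergence of the dilaton current. -/
theorem traceDensity_S10
    (H : IsSelfDualBrane η U x θ (fun z => Real.exp (σ z)) (rho θ)) (hy : y ∈ U) :
    traceDensity θ x (MatrixExpr.S10 η) y
      = ((gravityDensity D (inducedMetric η x) σ y - ((D : ℝ) - 4) *
        ∑ μ, pd μ (dilatonCurrent (inducedMetric η x) σ μ) y : ℝ) : ℂ) := by
  have he : Real.exp (2 * σ y) = Real.exp (σ y) ^ 2 := by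
    rw [← Real.exp_nat_mul]
    norm_num
  rw [traceDensity, H.limit_S10 hy, divergence_dilatonCurrent H hy, gravityDensity,
    H.volume y hy, he, ← Complex.ofReal_mul]
  congr 1
  ring

theorem two_pi_sq_mul_traceLimit (A : MatrixExpr D) :
    ((2 * Real.pi : ℝ) : ℂ) ^ 2 * traceLimit U θ x A = ∫ y in U, traceDensity θ x A y := by
  have h : ((2 * Real.pi : ℝ) : ℂ) ≠ 0 :=
    Complex.ofReal_ne_zero.2 (mul_pos two_pos Real.pi_pos).ne'
  rw [traceLimit, ← mul_assoc, ← mul_pow, mul_inv_cancel₀ h, one_pow, one_mul]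

end Densities

end MatrixModel

end

theorem mainTheorem2 {D : ℕ} (η : Matrix (Fin D) (Fin D) ℝ) (hη : η.IsSymm) (hη' : η.det ≠ 0)
    (U : Set MatrixModel.Pt) (hU : IsOpen U)
    (x : Fin D → MatrixModel.Pt → ℝ) (hx : ∀ a, ContDiffOn ℝ ∞ (x a) U)
    (θ : MatrixModel.Pt → Matrix (Fin 4) (Fin 4) ℝ) (hθ : MatrixModel.IsSymplecticPoisson U θ)
    (g : MatrixModel.Pt → Matrix (Fin 4) (Fin 4) ℝ) (hg : g = MatrixModel.inducedMetric η x)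
    (hgdet : ∀ y ∈ U, (g y).det ≠ 0)
    (σ : MatrixModel.Pt → ℝ)
    (hσ : ∀ y ∈ U, Real.exp (-σ y) =
      MatrixModel.rho θ y / MatrixModel.sqrtDet (MatrixModel.effectiveMetric θ g σ) y)
    (hG : ∀ y ∈ U, MatrixModel.effectiveMetric θ g σ y = g y) :
    -- the limit of `T^{ab}` and the formula for `e^σ`
    (∀ y ∈ U, ∀ a b, (MatrixModel.MatrixExpr.T η a b).limit θ x y =
      ((Real.exp (σ y) * MatrixModel.normalProjector η x a b y : ℝ) : ℂ)) ∧
    (∀ y ∈ U, Real.exp (σ y) = 1 / 4 * ∑ a, ∑ b, ∑ c, ∑ d,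
      η a c * η b d * MatrixModel.pb θ (x a) (x b) y * MatrixModel.pb θ (x c) (x d) y) ∧
    -- the first term of order ten
    (MeasureTheory.IntegrableOn
        (MatrixModel.traceDensity θ x (MatrixModel.MatrixExpr.S10 η)) U →
      MeasureTheory.IntegrableOn (MatrixModel.gravityDensity D g σ) U →
      MatrixModel.NoBoundaryFlux U (MatrixModel.dilatonCurrent g σ) →
      ((2 * Real.pi : ℝ) : ℂ) ^ 2 *
          MatrixModel.traceLimit U θ x (MatrixModel.MatrixExpr.S10 η) =
        ((∫ y in U, MatrixModel.gravityDensity D g σ y : ℝ) : ℂ)) ∧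
    -- the second term of order ten
    (MeasureTheory.IntegrableOn
        (MatrixModel.traceDensity θ x (MatrixModel.MatrixExpr.S10tilde η)) U ↔
      MeasureTheory.IntegrableOn (MatrixModel.dilatonDensity g σ) U) ∧
    ((2 * Real.pi : ℝ) : ℂ) ^ 2 *
        MatrixModel.traceLimit U θ x (MatrixModel.MatrixExpr.S10tilde η) =
      ((-16 * ∫ y in U, MatrixModel.dilatonDensity g σ y : ℝ) : ℂ) := by
  open MatrixModel MeasureTheory in
  subst hg
  have H := isSelfDualBrane_of_effectiveMetric hη hη' hU hx hθ hgdet hσ hG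
  refine ⟨fun y hy a b => ?_, fun y hy => ?_, fun hI hJ hflux => ?_, ?_, ?_⟩
  · rw [H.limit_T hy, one_mul, normalMatrix_apply]
  · rw [sum_pb_sq (s := fun z => Real.exp (σ z)) hη (hgdet y hy) (H.effective y hy)]
    ring
  · set w := dilatonCurrent (inducedMetric η x) σ
    set d : ℝ := (D : ℝ) - 4
    have hI' : IntegrableOn (fun y => gravityDensity D (inducedMetric η x) σ y
        - d * ∑ μ, pd μ (w μ) y) U := by
      have h1 := (hI.congr_fun (fun y hy => traceDensity_S10 H hy) hU.measurableSet).re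
      exact h1.congr (Filter.Eventually.of_forall fun y => Complex.ofReal_re _)
    -- For `D = 4` the divergence need not be integrable, but it does not contribute.
    have hdiv : IntegrableOn (fun y => d * ∑ μ, pd μ (w μ) y) U :=
      (hJ.sub hI').congr (Filter.Eventually.of_forall fun y => sub_sub_cancel _ _)
    have hzero : ∫ y in U, d * ∑ μ, pd μ (w μ) y = 0 := by
      rcases eq_or_ne d 0 with h0 | h0
      · simp [h0]
      · have h2 : IntegrableOn (fun y => ∑ μ, pd μ (w μ) y) U :=
          (hdiv.const_mul d⁻¹).congr (Filter.Eventually.of_forall fun y =>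
            inv_mul_cancel_left₀ h0 _)
        rw [integral_const_mul,
          setIntegral_divergence_eq_zero hU (dilatonCurrent_smooth H) hflux h2, mul_zero]
    rw [two_pi_sq_mul_traceLimit,
      setIntegral_congr_fun hU.measurableSet fun y hy => traceDensity_S10 H hy,
      integral_complex_ofReal, integral_sub hJ hdiv, hzero, sub_zero]
  · constructor
    · intro hI
      have h1 := (hI.congr_fun (fun y hy => traceDensity_S10tilde H hy) hU.measurableSet).re
      refine (Integrable.const_mul h1 (-(1 / 16))).congr (Filter.Eventually.of_forall fun y => ?_)
      change -(1 / 16) * (Complex.re ((-16 * dilatonDensity (inducedMetric η x) σ y : ℝ) : ℂ))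
        = dilatonDensity (inducedMetric η x) σ y
      rw [Complex.ofReal_re]
      ring
    · intro hI
      have h1 : IntegrableOn
          (fun y => ((-16 * dilatonDensity (inducedMetric η x) σ y : ℝ) : ℂ)) U :=
        Integrable.ofReal (Integrable.const_mul hI (-16))
      exact h1.congr_fun (fun y hy => (traceDensity_S10tilde H hy).symm) hU.measurableSet
  · rw [two_pi_sq_mul_traceLimit,
      setIntegral_congr_fun hU.measurableSet fun y hy => traceDensity_S10tilde H hy,
      integral_complex_ofReal, integral_const_mul]
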